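/- Fix $D$, a lifetime $\lambda>0$ and a prior strength $\gamma>0$. All data sets are finite, nonempty families $\mathbf X=(\mathbf x_i)_{i\in N}$ of points of $\mathbb R^D$ (repetitions allowed). For $M\subseteq N$ nonempty, let $\mathbf l^M,\mathbf u^M$ be the coordinatewise minimum and maximum of $(\mathbf x_i)_{i\in M}$. **Mondrian tree.** The block on $M$ with parent time $s$ is the following random binary tree. Its root stores $M$, the box $B=\prod_d[l^M_d,u^M_d]$ and a restriction counter equal to $|M|$. Sample $E\sim\mathrm{Exp}\big(\sum_d(u^M_d-l^M_d)\big)$, where $E=\infty$ if the rate is $0$. If $s+E\ge\lambda$, the root is a leaf with time $\lambda$. Otherwise it has time $\tau=s+E$; choose a dimension $\delta$ with probability proportional to $u^M_\delta-l^M_\delta$ and $\xi$ uniformly on $[l^M_\delta,u^M_\delta]$; store $(\delta,\xi)$ and cut counters equal to the numbers of points of $M$ with coordinate $\delta$ at most, respectively greater than, $\xi$; the left and right subtrees are independent blocks on these two sets of points with parent time $\tau$. The Mondrian tree on $\mathbf X$ is the block on $N$ with parent time $0$. **Pólya parameters.** They are attached to a stored tree as follows. The root has depth $0$ and mass $P=1$.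 A node that is a leaf, or whose box $B_j$ has a side of length $0$, is an observed leaf of the Pólya tree; no parameters are attached to it, nor anything to its descendants. At any other node $j$, of depth $d_j$ and mass $P_j$, the cut splits $B_j$ into $R_{j0},R_{j1}$ (below, above the cut), and for $k=0,1$ $$\chi_{jk}=\gamma(2d_j+1)^2\frac{\mathrm{vol}\,R_{jk}}{\mathrm{vol}\,R_{j0}+\mathrm{vol}\,R_{j1}}+c_{jk},$$ where $c_{jk}$ are the cut counters of $j$. If the box $B_{jk}$ of the $k$-th child has all side lengths positive, then with $V_\in=\mathrm{vol}\,B_{jk}$, $V_\neg=\mathrm{vol}\,R_{jk}-V_\in$ and $r_{jk}$ the restriction counter of that child, $$\rho_{jk\in}=\gamma(2d_j+2)^2\frac{V_\in}{V_\in+V_\neg}+r_{jk},\qquad \rho_{jk\neg}=\gamma(2d_j+2)^2\frac{V_\neg}{V_\in+V_\neg}.$$ With $\mu_0=\chi_{j0}/(\chi_{j0}+\chi_{j1})$ and $\mu_1=1-\mu_0$, the $k$-th child has mass $P_j\mu_k\,\rho_{jk\in}/(\rho_{jk\in}+\rho_{jk\neg})$, or $P_j\mu_k$ if $B_{jk}$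 has a side of length $0$. The Mondrian tree on $\mathbf X$ together with these masses and parameters is the streaming Mondrian Pólya tree; its law is denoted $\mathrm{MPT}(\mathbf X,\lambda)$. **Insertion.** A point $\mathbf z$ with a new index is inserted into a stored tree by the following procedure, started at the root with $s=0$. At a node $j$ with time $\tau_j$, box corners $\mathbf l,\mathbf u$, index set $N(j)$ and parent time $s$, put $e_d=\max(l_d-z_d,0)+\max(z_d-u_d,0)$ and sample $E\sim\mathrm{Exp}(\sum_d e_d)$, where $E=\infty$ if the rate is $0$. * If $s+E<\tau_j$: choose $\delta$ with probability proportional to $e_\delta$ and $\xi$ uniformly between $z_\delta$ and the box (on $[u_\delta,z_\delta]$ if $z_\delta>u_\delta$, else on $[z_\delta,l_\delta]$). Put a new node with time $s+E$ and cut $(\delta,\xi)$ in place of $j$. Its index set is $N(j)$ together with the index of $\mathbf z$, its box is the smallest box containing that of $j$ and $\mathbf z$, its restriction counter is that of $j$ plus $1$, and its cut counters are $|N(j)|$ and $1$ on the respective sides. Its children are the unchanged subtree at $j$ and a new leaf $\{\mathbf z\}$ with time $\lambda$ and restriction counter $1$, the latter on the right if $z_\delta>\xi$ and on the left otherwise.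 Stop. * Otherwise: add the index of $\mathbf z$ to $N(j)$, extend the box of $j$ to contain $\mathbf z$ and increment the restriction counter of $j$ by $1$. If $j$ is a leaf, stop. If not, increment by $1$ the cut counter of $j$ on the side of its cut on which $\mathbf z$ lies, and continue at the child on that side, with parent time $\tau_j$. Finally, the masses and parameters are those attached, by the formulas above, to the resulting boxes, cuts, depths and counters. Write $\mathrm{Insert}(T,\mathbf z)$ for the law of the result. **Lemma.** $\mathrm{MPT}(\mathbf X,\lambda)$ and, for every tree $T$, $\mathrm{Insert}(T,\mathbf z)$ are probability measures, and if $T\sim\mathrm{MPT}(\mathbf X,\lambda)$ and $T'\mid T\sim\mathrm{Insert}(T,\mathbf z)$, then $T'\sim\mathrm{MPT}(\mathbf X\cup\{\mathbf z\},\lambda)$. -/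

import Mathlib

open MeasureTheory ProbabilityTheory

noncomputable section

/-- The disjoint-union `σ`-algebra on `Option α`. -/
instance MPT.optionMeasurableSpace {α : Type*} [MeasurableSpace α] :
    MeasurableSpace (Option α) :=
  MeasurableSpace.comap (Equiv.optionEquivSumPUnit.{0} α) inferInstance

namespace MPT

/-! ### Stored trees -/

/-- The data stored at every node `j` of a Mondrian tree: the set `N(j)` of indices of the
observations at `j`, the corners `l_j`, `u_j` of the bounding box `B_j`, the time `τ_j`, and the
counter of the observed-restriction Beta parameter, i.e. the number of observations that have been
recorded as falling in the observed region `B_j`. -/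
structure NodeData (D : ℕ) where
  idx : Finset ℕ
  lo : Fin D → ℝ
  hi : Fin D → ℝ
  time : ℝ
  obs : ℕ

/-- The additional data stored at an internal node `j`: the cut dimension `δ_j`, the cut location
`ξ_j`, and the two counters of the cut Beta parameters, i.e. the numbers of observations that have
been recorded as falling below (`cnt0`) and above (`cnt1`) the cut. -/
structure CutData (D : ℕ) where
  dim : Fin D
  loc : ℝ
  cnt0 : ℕ
  cnt1 : ℕ

instance (D : ℕ) : MeasurableSpace (NodeData D) :=
  MeasurableSpace.comap (fun a => (a.idx, a.lo, a.hi, a.time, a.obs)) inferInstance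

instance (D : ℕ) : MeasurableSpace (CutData D) :=
  MeasurableSpace.comap (fun c => (c.dim, c.loc, c.cnt0, c.cnt1)) inferInstance

/-- A finite binary tree with the above node data. The first subtree of an internal node is the
left child (below the cut), the second one is the right child (above the cut). -/
inductive MTree (D : ℕ) where
  | leaf : NodeData D → MTree D
  | node : NodeData D → CutData D → MTree D → MTree D → MTree D

/-- The node data at the root. -/
def MTree.root {D : ℕ} : MTree D → NodeData D
  | .leaf a => a
  | .node a _ _ _ => a

/-- The label found at the address `b` (`false` = left, `true` = right); `none` if the tree has no
node at that address. Leaves carry no cut data. -/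
def MTree.label {D : ℕ} : MTree D → List Bool → Option (NodeData D × Option (CutData D))
  | .leaf a, [] => some (a, none)
  | .leaf _, _ :: _ => none
  | .node a c _ _, [] => some (a, some c)
  | .node _ _ L _, false :: b => L.label b
  | .node _ _ _ R, true :: b => R.label b

/-- The `σ`-algebra on trees generated by the labels at all addresses. -/
instance (D : ℕ) : MeasurableSpace (MTree D) :=
  MeasurableSpace.comap MTree.label inferInstance

/-! ### Sampling a Mondrian tree -/

/-- Coordinatewise minimum of the observations `x i`, `i ∈ N` (for nonempty `N`). -/
def lower {D : ℕ} (x : ℕ → Fin D → ℝ) (N : Finset ℕ) (d : Fin D) : ℝ :=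
  if h : N.Nonempty then N.inf' h (fun i => x i d) else 0

/-- Coordinatewise maximum of the observations `x i`, `i ∈ N` (for nonempty `N`). -/
def upper {D : ℕ} (x : ℕ → Fin D → ℝ) (N : Finset ℕ) (d : Fin D) : ℝ :=
  if h : N.Nonempty then N.sup' h (fun i => x i d) else 0

/-- The law of a random cut `(δ, ξ)`: the dimension `δ` is chosen with probability proportional to
the weight `w δ`, and then `ξ` is uniform on the interval `[a δ, b δ]`. -/
def cutLaw {D : ℕ} (w a b : Fin D → ℝ) : Measure (Fin D × ℝ) :=
  ∑ d, ENNReal.ofReal (w d / ∑ i, w i) • (cond volume (Set.Icc (a d) (b d))).map (Prod.mk d)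

/-- The node data of a freshly created node with observations `N` and time `t`. -/
def freshData {D : ℕ} (x : ℕ → Fin D → ℝ) (N : Finset ℕ) (t : ℝ) : NodeData D :=
  ⟨N, lower x N, upper x N, t, N.card⟩

/-- Indices of the observations at most the cut. -/
def below {D : ℕ} (x : ℕ → Fin D → ℝ) (N : Finset ℕ) (c : Fin D × ℝ) : Finset ℕ :=
  N.filter fun i => x i c.1 ≤ c.2

/-- Indices of the observations greater than the cut. -/
def above {D : ℕ} (x : ℕ → Fin D → ℝ) (N : Finset ℕ) (c : Fin D × ℝ) : Finset ℕ :=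
  N.filter fun i => c.2 < x i c.1

open Classical in
/-- The law of the Mondrian block (subtree) with lifetime `lam` on the observations `x i`, `i ∈ N`,
whose parent has time `s`. The waiting time `E` is exponential with rate the linear dimension
`∑ d, (u_d - l_d)` of the bounding box (`E = ∞` for rate `0`). If `s + E < lam`, the box is cut and
the two sides are sampled independently from time `s + E` on; otherwise the block is a leaf with
time `lam`. (The last test only excludes cuts leaving one of the two sides without observations;
such cuts have probability zero.) -/
def block {D : ℕ} (lam : ℝ) (x : ℕ → Fin D → ℝ) (N : Finset ℕ) (s : ℝ) : Measure (MTree D) :=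
  let halt : Measure (MTree D) := Measure.dirac (.leaf (freshData x N lam))
  let len : Fin D → ℝ := fun d => upper x N d - lower x N d
  if ∑ d, len d = 0 then halt
  else
    (expMeasure (∑ d, len d)).bind fun E =>
      if s + E < lam then
        (cutLaw len (lower x N) (upper x N)).bind fun c =>
          if _h : (below x N c).card < N.card ∧ (above x N c).card < N.card then
            ((block lam x (below x N c) (s + E)).prod (block lam x (above x N c) (s + E))).map
              fun T => .node (freshData x N (s + E))
                ⟨c.1, c.2, (below x N c).card, (above x N c).card⟩ T.1 T.2
          else halt
      else halt
termination_by N.card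
decreasing_by
  · exact _h.1
  · exact _h.2

/-- The law of a Mondrian tree (with counters) on the observations `x i`, `i ∈ N`, with lifetime
`lam`: time starts at `0`. -/
def mondrianTree {D : ℕ} (lam : ℝ) (x : ℕ → Fin D → ℝ) (N : Finset ℕ) : Measure (MTree D) :=
  block lam x N 0

/-! ### Inserting an observation into a tree -/

/-- Extent by which `z` lies below (`extLo`) or above (`extHi`) the box `[l, u]`. -/
def extLo {D : ℕ} (l z : Fin D → ℝ) (d : Fin D) : ℝ := max (l d - z d) 0

/-- See `extLo`. -/
def extHi {D : ℕ} (u z : Fin D → ℝ) (d : Fin D) : ℝ := max (z d - u d) 0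

/-- Node data after the observation `z`, of index `k`, has been recorded at the node: the box is
extended to contain `z` and the observed-restriction counter is incremented. -/
def NodeData.add {D : ℕ} (k : ℕ) (z : Fin D → ℝ) (a : NodeData D) : NodeData D :=
  { a with
    idx := insert k a.idx
    lo := fun d => min (a.lo d) (z d)
    hi := fun d => max (a.hi d) (z d)
    obs := a.obs + 1 }

/-- The tree obtained from `T` by inserting, above its root, a new node with time `t` and cut `c`
that separates `z` from all observations of `T`; the sibling of `T` is a leaf containing `z`. -/
def newParent {D : ℕ} (lam : ℝ) (k : ℕ) (z : Fin D → ℝ) (T : MTree D) (t : ℝ)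
    (c : Fin D × ℝ) : MTree D :=
  let a : NodeData D := { T.root.add k z with time := t }
  let sib : MTree D := .leaf ⟨{k}, z, z, lam, 1⟩
  if c.2 < z c.1 then .node a ⟨c.1, c.2, T.root.idx.card, 1⟩ T sib
  else .node a ⟨c.1, c.2, 1, T.root.idx.card⟩ sib T

open Classical in
/-- One step of the insertion at the root of a (sub)tree `T` whose parent has time `s`. The waiting
time `E` is exponential with rate `∑ d, (extLo d + extHi d)` (`E = ∞` for rate `0`). If `s + E`
precedes the time of the root of `T`, a new parent is inserted above `T`, with a random cut in the
extension of the box; otherwise the insertion continues as described by the law `stay`. -/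
def insertStep {D : ℕ} (lam : ℝ) (k : ℕ) (z : Fin D → ℝ) (T : MTree D) (s : ℝ)
    (stay : Measure (MTree D)) : Measure (MTree D) :=
  let l := T.root.lo
  let u := T.root.hi
  let e : Fin D → ℝ := fun d => extLo l z d + extHi u z d
  if ∑ d, e d = 0 then stay
  else
    (expMeasure (∑ d, e d)).bind fun E =>
      if s + E < T.root.time then
        (cutLaw e (fun d => if u d < z d then u d else z d)
            (fun d => if u d < z d then z d else l d)).map (newParent lam k z T (s + E))
      else stay

/-- The law of the (sub)tree resulting from the insertion of the observation `z`, of index `k`,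
into the (sub)tree with lifetime `lam` whose parent has time `s`. If no new parent is inserted, the
root records `z`, and if it is not a leaf, the cut counter on the side of `z` is incremented and `z`
is inserted into the child on that side. -/
def insertBlock {D : ℕ} (lam : ℝ) (k : ℕ) (z : Fin D → ℝ) : MTree D → ℝ → Measure (MTree D)
  | .leaf a, s => insertStep lam k z (.leaf a) s (Measure.dirac (.leaf (a.add k z)))
  | .node a c L R, s => insertStep lam k z (.node a c L R) s <|
      if z c.dim ≤ c.loc then
        (insertBlock lam k z L a.time).map fun L' =>
          .node (a.add k z) { c with cnt0 := c.cnt0 + 1 } L' R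
      else
        (insertBlock lam k z R a.time).map fun R' =>
          .node (a.add k z) { c with cnt1 := c.cnt1 + 1 } L R'

/-! ### Beta parameters -/

/-- All side lengths of the box are positive. -/
def NodeData.Solid {D : ℕ} (a : NodeData D) : Prop := ∀ d, a.lo d < a.hi d

/-- The volume `V_{B_j}` of the bounding box. -/
def NodeData.vol {D : ℕ} (a : NodeData D) : ℝ := ∏ d, (a.hi d - a.lo d)

/-- The volume `V_{R_{j0}}` of the part of the box below the cut. -/
def regionVol0 {D : ℕ} (a : NodeData D) (c : CutData D) : ℝ :=
  a.vol / (a.hi c.dim - a.lo c.dim) * |a.lo c.dim - c.loc|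

/-- The volume `V_{R_{j1}}` of the part of the box above the cut. -/
def regionVol1 {D : ℕ} (a : NodeData D) (c : CutData D) : ℝ :=
  a.vol / (a.hi c.dim - a.lo c.dim) * |a.hi c.dim - c.loc|

/-- The pair of posterior cut parameters `(χ_{j0}, χ_{j1})` at a node of depth `n`: prior parameters
plus counters. -/
def cutParams {D : ℕ} (γ : ℝ) (n : ℕ) (a : NodeData D) (c : CutData D) : ℝ × ℝ :=
  let V0 := regionVol0 a c
  let V1 := regionVol1 a c
  (γ * (2 * n + 1) ^ 2 * (V0 / (V0 + V1)) + c.cnt0,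
   γ * (2 * n + 1) ^ 2 * (V1 / (V0 + V1)) + c.cnt1)

open Classical in
/-- The pair of posterior restriction parameters `(ρ_{jk∈}, ρ_{jk¬})` at a node `j` of depth `n`,
for the child with data `a'`, where `V` is the volume of `R_{jk}`. There is no restriction (`none`)
if the box of the child has a side of length zero. -/
def restrictParams {D : ℕ} (γ : ℝ) (n : ℕ) (V : ℝ) (a' : NodeData D) : Option (ℝ × ℝ) :=
  if a'.Solid then
    let Vobs := a'.vol
    let Vcomp := V - a'.vol
    some (γ * (2 * n + 2) ^ 2 * (Vobs / (Vobs + Vcomp)) + a'.obs,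
      γ * (2 * n + 2) ^ 2 * (Vcomp / (Vobs + Vcomp)))
  else none

/-- The expected value of a Beta distribution. -/
def betaMean (p : ℝ × ℝ) : ℝ := p.1 / (p.1 + p.2)

/-- The fraction of mass kept by the observed region (everything if there is no restriction). -/
def keptFraction (r : Option (ℝ × ℝ)) : ℝ := r.elim 1 betaMean

/-- The Pólya tree quantities attached to a node: its probability mass `P_j`, and, unless the node
is an observed leaf (of type I or II), its cut parameters and the restriction parameters on either
side of the cut. -/
structure PolyaData where
  mass : ℝ
  cut : Option (ℝ × ℝ)
  restrict0 : Option (ℝ × ℝ)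
  restrict1 : Option (ℝ × ℝ)

instance : MeasurableSpace PolyaData :=
  MeasurableSpace.comap (fun p => (p.mass, p.cut, p.restrict0, p.restrict1)) inferInstance

open Classical in
/-- The Pólya tree quantities, by address, of the (sub)tree whose root has depth `n` and mass `P`.
Nodes whose box has a side of length zero are treated as (type I) observed leaves. -/
def polya {D : ℕ} (γ : ℝ) : MTree D → ℕ → ℝ → List Bool → Option PolyaData
  | .leaf _, _, P, [] => some ⟨P, none, none, none⟩
  | .leaf _, _, _, _ :: _ => none
  | .node a c L R, n, P, [] =>
      if a.Solid then
        some ⟨P, some (cutParams γ n a c), restrictParams γ n (regionVol0 a c) L.root,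
          restrictParams γ n (regionVol1 a c) R.root⟩
      else some ⟨P, none, none, none⟩
  | .node a c L R, n, P, false :: b =>
      if a.Solid then
        polya γ L (n + 1) (P * betaMean (cutParams γ n a c) *
          keptFraction (restrictParams γ n (regionVol0 a c) L.root)) b
      else none
  | .node a c L R, n, P, true :: b =>
      if a.Solid then
        polya γ R (n + 1) (P * (1 - betaMean (cutParams γ n a c)) *
          keptFraction (restrictParams γ n (regionVol1 a c) R.root)) b
      else none

/-! ### Streaming Mondrian Pólya trees -/

/-- A Mondrian Pólya tree: a stored Mondrian tree together with the Pólya tree quantities at its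
nodes. -/
abbrev MPTree (D : ℕ) : Type := MTree D × (List Bool → Option PolyaData)

/-- Attach the Pólya tree quantities to a stored tree; the root has depth `0` and mass `1`. -/
def withPolya {D : ℕ} (γ : ℝ) (T : MTree D) : MPTree D := (T, polya γ T 0 1)

/-- The law of the streaming Mondrian Pólya tree with lifetime `lam` and prior strength `γ` on the
observations `x i`, `i ∈ N`. -/
def mondPolyaTree {D : ℕ} (γ lam : ℝ) (x : ℕ → Fin D → ℝ) (N : Finset ℕ) :
    Measure (MPTree D) :=
  (mondrianTree lam x N).map (withPolya γ)

/-- The law of the tree resulting from the insertion of the observation `z`, of index `k`, into the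
Mondrian Pólya tree `T`. -/
def insertMPTree {D : ℕ} (γ lam : ℝ) (k : ℕ) (z : Fin D → ℝ) (T : MPTree D) :
    Measure (MPTree D) :=
  (insertBlock lam k z T.1 0).map (withPolya γ)

end MPT

end

noncomputable section

namespace MPT

/-! ### Measurability of optional values, node data and trees -/

/-! The argument is one of competing exponential clocks. Let L be the sum of the side lengths of the
box of the old observations and Λ the total extension needed to reach the new one; the box of all
observations has linear dimension L + Λ (`sum_length_insert`). The rate of a clock is also the
normalising constant of the cut drawn when it rings, so the two cancel: root time and cut of a block
have joint density exp(-L(t-s)) dt against an unnormalised cut measure (`lintegral_waitLaw_cut`),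
which is Lebesgue measure on each side of the box. That measure is additive: the cuts of the
enlarged box are those of the old box together with those of the extension (`cutMeas_insert`).

Integrate a test function against a block followed by an insertion. If the old root time t comes
first, the insertion clock survives with factor exp(-Λ(t-s)), the exponents add up, and the
insertion continues on one side of a cut of the old box. That side has fewer observations, so strong
induction on their number applies (`lintegral_stay_part`). If the insertion clock rings first, at
time t, memorylessness (`lintegral_block_time`) replaces the old block by a block started at t, with
the factor exp(-L(t-s)). The new parent on top of it is then a cut of the enlarged box inside the
extension, with the old observations on one side and the new one alone on the other
(`lintegral_newParent_part`). The two contributions sum to the root decomposition of the block on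
all observations (`lintegral_block`).

Composing laws by `Measure.bind` is meaningful only for measurable kernels, which accounts for most
of the preliminaries. The Pólya quantities are a measurable deterministic function of the stored
tree and are recomputed after an insertion, so the identity for stored trees pushes forward. -/

theorem measurable_some {α : Type*} [MeasurableSpace α] : Measurable (some : α → Option α) := by
  refine measurable_comap_iff.2 ?_
  exact measurable_inl

/-- In the disjoint-union σ-algebra `none` is a separate one-point summand, which imposes no
condition. -/
theorem measurable_option_iff {α β : Type*} [MeasurableSpace α] [MeasurableSpace β]
    {f : Option α → β} : Measurable f ↔ Measurable fun a => f (some a) := by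
  refine ⟨fun h => h.comp measurable_some, fun h => ?_⟩
  have : f = (Sum.elim (fun a => f (some a)) fun _ : PUnit.{1} => f none) ∘
      Equiv.optionEquivSumPUnit.{0} α := by
    funext o
    cases o <;> rfl
  rw [this]
  exact (h.sumElim measurable_const).comp (comap_measurable _)

theorem measurable_isSome {α : Type*} [MeasurableSpace α] :
    Measurable (Option.isSome : Option α → Bool) :=
  measurable_option_iff.2 measurable_const

theorem measurable_getD {α : Type*} [MeasurableSpace α] (a : α) :
    Measurable fun o : Option α => o.getD a :=
  measurable_option_iff.2 measurable_id

variable {D : ℕ}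

theorem measurable_nodeData_tuple :
    Measurable fun a : NodeData D => (a.idx, a.lo, a.hi, a.time, a.obs) :=
  comap_measurable _

@[fun_prop]
theorem measurable_idx : Measurable (NodeData.idx : NodeData D → _) :=
  measurable_nodeData_tuple.fst

@[fun_prop]
theorem measurable_lo : Measurable (NodeData.lo : NodeData D → _) :=
  measurable_nodeData_tuple.snd.fst

@[fun_prop]
theorem measurable_hi : Measurable (NodeData.hi : NodeData D → _) :=
  measurable_nodeData_tuple.snd.snd.fst

@[fun_prop]
theorem measurable_time : Measurable (NodeData.time : NodeData D → _) :=
  measurable_nodeData_tuple.snd.snd.snd.fst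

@[fun_prop]
theorem measurable_obs : Measurable (NodeData.obs : NodeData D → _) :=
  measurable_nodeData_tuple.snd.snd.snd.snd

theorem measurable_cutData_tuple :
    Measurable fun c : CutData D => (c.dim, c.loc, c.cnt0, c.cnt1) :=
  comap_measurable _

@[fun_prop]
theorem measurable_dim : Measurable (CutData.dim : CutData D → _) :=
  measurable_cutData_tuple.fst

@[fun_prop]
theorem measurable_loc : Measurable (CutData.loc : CutData D → _) :=
  measurable_cutData_tuple.snd.fst

@[fun_prop]
theorem measurable_cnt0 : Measurable (CutData.cnt0 : CutData D → _) :=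
  measurable_cutData_tuple.snd.snd.fst

@[fun_prop]
theorem measurable_cnt1 : Measurable (CutData.cnt1 : CutData D → _) :=
  measurable_cutData_tuple.snd.snd.snd

section

variable {α : Type*} [MeasurableSpace α]

@[fun_prop]
theorem measurable_nodeData_mk {i : α → Finset ℕ} {l u : α → Fin D → ℝ} {t : α → ℝ} {n : α → ℕ}
    (hi : Measurable i) (hl : Measurable l) (hu : Measurable u) (ht : Measurable t)
    (hn : Measurable n) : Measurable fun a => (⟨i a, l a, u a, t a, n a⟩ : NodeData D) :=
  measurable_comap_iff.2 (hi.prodMk (hl.prodMk (hu.prodMk (ht.prodMk hn))))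

@[fun_prop]
theorem measurable_cutData_mk {i : α → Fin D} {x : α → ℝ} {n m : α → ℕ}
    (hi : Measurable i) (hx : Measurable x) (hn : Measurable n) (hm : Measurable m) :
    Measurable fun a => (⟨i a, x a, n a, m a⟩ : CutData D) :=
  measurable_comap_iff.2 (hi.prodMk (hx.prodMk (hn.prodMk hm)))

theorem measurable_mtree_iff {f : α → MTree D} :
    Measurable f ↔ ∀ b, Measurable fun a => (f a).label b :=
  measurable_comap_iff.trans measurable_pi_iff

theorem measurable_label (b : List Bool) : Measurable fun T : MTree D => T.label b :=
  measurable_mtree_iff.1 measurable_id b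

@[fun_prop]
theorem measurable_leaf {f : α → NodeData D} (hf : Measurable f) :
    Measurable fun a => MTree.leaf (f a) := by
  refine measurable_mtree_iff.2 fun b => ?_
  cases b with
  | nil => exact measurable_some.comp (hf.prodMk measurable_const)
  | cons _ _ => exact measurable_const

@[fun_prop]
theorem measurable_node {f : α → NodeData D} {c : α → CutData D} {L R : α → MTree D}
    (hf : Measurable f) (hc : Measurable c) (hL : Measurable L) (hR : Measurable R) :
    Measurable fun a => MTree.node (f a) (c a) (L a) (R a) := by
  refine measurable_mtree_iff.2 fun b => ?_
  cases b with
  | nil => exact measurable_some.comp (hf.prodMk (measurable_some.comp hc))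
  | cons e b =>
    cases e
    · exact (measurable_label b).comp hL
    · exact (measurable_label b).comp hR

end

/-- The root label of a tree. -/
def MTree.rootLabel (T : MTree D) : NodeData D × Option (CutData D) :=
  (T.label []).getD (⟨∅, 0, 0, 0, 0⟩, none)

theorem measurable_rootLabel : Measurable (MTree.rootLabel : MTree D → _) :=
  (measurable_getD _).comp (measurable_label [])

@[fun_prop]
theorem measurable_root : Measurable (MTree.root : MTree D → _) := by
  have : (MTree.root : MTree D → _) = fun T => T.rootLabel.1 := by
    funext T
    cases T <;> rfl
  rw [this]
  exact measurable_rootLabel.fst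

/-- Whether a tree has a cut at its root. -/
def MTree.isNode (T : MTree D) : Bool := T.rootLabel.2.isSome

theorem measurable_isNode : Measurable (MTree.isNode : MTree D → _) :=
  measurable_isSome.comp measurable_rootLabel.snd

theorem measurableSet_isNode : MeasurableSet {T : MTree D | T.isNode = true} :=
  measurable_isNode (measurableSet_singleton true)

/-- The left subtree; a leaf is its own left subtree. -/
def MTree.left : MTree D → MTree D
  | .leaf a => .leaf a
  | .node _ _ L _ => L

/-- The right subtree; a leaf is its own right subtree. -/
def MTree.right : MTree D → MTree D
  | .leaf a => .leaf a
  | .node _ _ _ R => R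

/-- Passing to a subtree only shifts addresses, and the σ-algebra on trees is generated by the
labels at fixed addresses. -/
theorem measurable_left : Measurable (MTree.left : MTree D → _) := by
  refine measurable_mtree_iff.2 fun b => ?_
  have : (fun T : MTree D => T.left.label b) =
      fun T => if T.isNode = true then T.label (false :: b) else T.label b := by
    funext T
    cases T <;> rfl
  rw [this]
  exact Measurable.ite measurableSet_isNode (measurable_label _) (measurable_label _)

theorem measurable_right : Measurable (MTree.right : MTree D → _) := by
  refine measurable_mtree_iff.2 fun b => ?_
  have : (fun T : MTree D => T.right.label b) =
      fun T => if T.isNode = true then T.label (true :: b) else T.label b := by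
    funext T
    cases T <;> rfl
  rw [this]
  exact Measurable.ite measurableSet_isNode (measurable_label _) (measurable_label _)

/-- A function on trees (with a parameter) is measurable if it is so on leaves and on nodes. -/
theorem measurable_mtree_cases {α β : Type*} [MeasurableSpace α] [MeasurableSpace β]
    {g : MTree D → α → β}
    (h1 : Measurable fun p : NodeData D × α => g (.leaf p.1) p.2)
    (h2 : Measurable fun p : (NodeData D × CutData D × MTree D × MTree D) × α =>
      g (.node p.1.1 p.1.2.1 p.1.2.2.1 p.1.2.2.2) p.2) :
    Measurable fun p : MTree D × α => g p.1 p.2 := by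
  -- A default cut is needed to read off the root cut by `getD`. For D = 0 there is none, but then
  -- every tree is a leaf.
  rcases isEmpty_or_nonempty (CutData D) with hD | ⟨⟨c₀⟩⟩
  · have : (fun p : MTree D × α => g p.1 p.2) = fun p => g (.leaf p.1.root) p.2 := by
      funext p
      obtain ⟨T, a⟩ := p
      cases T with
      | leaf _ => rfl
      | node _ c _ _ => exact hD.elim c
    rw [this]
    exact h1.comp (f := fun p : MTree D × α => (p.1.root, p.2)) (by fun_prop)
  · have : (fun p : MTree D × α => g p.1 p.2) = fun p => if p.1.isNode = true then
        g (.node p.1.root (p.1.rootLabel.2.getD c₀) p.1.left p.1.right) p.2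
        else g (.leaf p.1.root) p.2 := by
      funext p
      obtain ⟨T, a⟩ := p
      cases T <;> rfl
    rw [this]
    refine Measurable.ite (measurable_fst measurableSet_isNode) ?_ ?_
    · refine h2.comp (f := fun p : MTree D × α =>
        ((p.1.root, p.1.rootLabel.2.getD c₀, p.1.left, p.1.right), p.2)) ?_
      refine Measurable.prodMk (Measurable.prodMk (by fun_prop) (Measurable.prodMk ?_
        (Measurable.prodMk ?_ ?_))) measurable_snd
      · exact (measurable_getD c₀).comp (measurable_rootLabel.snd.comp measurable_fst)
      · exact measurable_left.comp measurable_fst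
      · exact measurable_right.comp measurable_fst
    · exact h1.comp (f := fun p : MTree D × α => (p.1.root, p.2)) (by fun_prop)

/-! ### Measurability of the Pólya parameters and of the operations on trees -/

section

variable {D : ℕ} {α : Type*} [MeasurableSpace α]

theorem measurable_apply_dim {f : α → Fin D → ℝ} {i : α → Fin D} (hf : Measurable f)
    (hi : Measurable i) : Measurable fun a => f a (i a) := by
  have h : Measurable fun p : (Fin D → ℝ) × Fin D => p.1 p.2 :=
    measurable_from_prod_countable_left fun d => measurable_pi_apply d
  exact h.comp (hf.prodMk hi)

theorem measurableSet_solid : MeasurableSet {a : NodeData D | a.Solid} := by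
  have : {a : NodeData D | a.Solid} = ⋂ d, {a | a.lo d < a.hi d} := by
    ext a
    simp [NodeData.Solid]
  rw [this]
  exact MeasurableSet.iInter fun d => measurableSet_lt (by fun_prop) (by fun_prop)

@[fun_prop]
theorem measurable_vol : Measurable (NodeData.vol : NodeData D → ℝ) := by
  unfold NodeData.vol
  exact Finset.measurable_prod _ fun d _ => by fun_prop

@[fun_prop]
theorem measurable_regionVol0 {a : α → NodeData D} {c : α → CutData D} (ha : Measurable a)
    (hc : Measurable c) : Measurable fun t => regionVol0 (a t) (c t) := by
  have h0 := measurable_apply_dim (measurable_lo.comp ha) (measurable_dim.comp hc)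
  have h1 := measurable_apply_dim (measurable_hi.comp ha) (measurable_dim.comp hc)
  simp only [Function.comp_def] at h0 h1
  unfold regionVol0
  simp only [← Real.norm_eq_abs]
  fun_prop

@[fun_prop]
theorem measurable_regionVol1 {a : α → NodeData D} {c : α → CutData D} (ha : Measurable a)
    (hc : Measurable c) : Measurable fun t => regionVol1 (a t) (c t) := by
  have h0 := measurable_apply_dim (measurable_lo.comp ha) (measurable_dim.comp hc)
  have h1 := measurable_apply_dim (measurable_hi.comp ha) (measurable_dim.comp hc)
  simp only [Function.comp_def] at h0 h1
  unfold regionVol1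
  simp only [← Real.norm_eq_abs]
  fun_prop

theorem measurable_natCast_real {n : α → ℕ} (hn : Measurable n) :
    Measurable fun t => (n t : ℝ) :=
  (measurable_of_countable _).comp hn

@[fun_prop]
theorem measurable_cutParams (γ : ℝ) (n : ℕ) {a : α → NodeData D} {c : α → CutData D}
    (ha : Measurable a) (hc : Measurable c) :
    Measurable fun t => cutParams γ n (a t) (c t) := by
  have h0 := measurable_natCast_real (measurable_cnt0.comp hc)
  have h1 := measurable_natCast_real (measurable_cnt1.comp hc)
  simp only [Function.comp_def] at h0 h1
  unfold cutParams
  fun_prop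

@[fun_prop]
theorem measurable_restrictParams (γ : ℝ) (n : ℕ) {V : α → ℝ} {a : α → NodeData D}
    (hV : Measurable V) (ha : Measurable a) :
    Measurable fun t => restrictParams γ n (V t) (a t) := by
  have h0 := measurable_natCast_real (measurable_obs.comp ha)
  simp only [Function.comp_def] at h0
  unfold restrictParams
  refine Measurable.ite (ha measurableSet_solid) (measurable_some.comp ?_) measurable_const
  fun_prop

theorem measurable_betaMean : Measurable betaMean := by
  unfold betaMean
  fun_prop

@[fun_prop]
theorem measurable_betaMean_comp {p : α → ℝ × ℝ} (hp : Measurable p) :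
    Measurable fun t => betaMean (p t) :=
  measurable_betaMean.comp hp

@[fun_prop]
theorem measurable_keptFraction {p : α → Option (ℝ × ℝ)} (hp : Measurable p) :
    Measurable fun t => keptFraction (p t) :=
  (measurable_option_iff.2 measurable_betaMean : Measurable keptFraction).comp hp

@[fun_prop]
theorem measurable_polyaData_mk {m : α → ℝ} {c r0 r1 : α → Option (ℝ × ℝ)} (hm : Measurable m)
    (hc : Measurable c) (h0 : Measurable r0) (h1 : Measurable r1) :
    Measurable fun t => (⟨m t, c t, r0 t, r1 t⟩ : PolyaData) :=
  measurable_comap_iff.2 (hm.prodMk (hc.prodMk (h0.prodMk h1)))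

/-- The induction is on the address, not on the tree: each address is reached in finitely many
steps, and each step changes the depth and the mass. The depth is therefore generalized and the mass
kept as a joint argument. -/
theorem measurable_polya (γ : ℝ) (b : List Bool) (n : ℕ) :
    Measurable fun p : MTree D × ℝ => polya γ p.1 n p.2 b := by
  induction b generalizing n with
  | nil =>
    refine measurable_mtree_cases (g := fun T P => polya γ T n P []) ?_ ?_
    · exact measurable_some.comp (by fun_prop)
    · simp only [polya]
      refine Measurable.ite
        ((by fun_prop : Measurable fun p : (NodeData D × CutData D × MTree D × MTree D) × ℝ =>
          p.1.1) measurableSet_solid) (measurable_some.comp ?_) (measurable_some.comp ?_)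
      · refine measurable_polyaData_mk (by fun_prop) (measurable_some.comp (by fun_prop))
          (by fun_prop) (by fun_prop)
      · fun_prop
  | cons e b ih =>
    refine measurable_mtree_cases (g := fun T P => polya γ T n P (e :: b)) ?_ ?_
    · exact measurable_const
    · have hS := (by fun_prop : Measurable fun p :
        (NodeData D × CutData D × MTree D × MTree D) × ℝ => p.1.1) measurableSet_solid
      cases e
      · simp only [polya]
        refine Measurable.ite hS ((ih (n + 1)).comp
          (f := fun p : (NodeData D × CutData D × MTree D × MTree D) × ℝ =>
            (p.1.2.2.1, _)) ?_) measurable_const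
        fun_prop
      · simp only [polya]
        refine Measurable.ite hS ((ih (n + 1)).comp
          (f := fun p : (NodeData D × CutData D × MTree D × MTree D) × ℝ =>
            (p.1.2.2.2, _)) ?_) measurable_const
        fun_prop

theorem measurable_withPolya (γ : ℝ) : Measurable (withPolya γ : MTree D → MPTree D) := by
  refine measurable_id.prodMk (measurable_pi_iff.2 fun b => ?_)
  exact (measurable_polya γ b 0).comp (f := fun T : MTree D => (T, (1 : ℝ))) (by fun_prop)

@[fun_prop]
theorem measurable_add (k : ℕ) (z : Fin D → ℝ) {a : α → NodeData D} (ha : Measurable a) :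
    Measurable fun t => (a t).add k z := by
  unfold NodeData.add
  have h : Measurable fun t => insert k (a t).idx :=
    (measurable_of_countable fun s : Finset ℕ => insert k s).comp (measurable_idx.comp ha)
  refine measurable_nodeData_mk h ?_ ?_ ?_ ?_
  · exact measurable_pi_iff.2 fun d => Measurable.min (by fun_prop) (by fun_prop)
  · exact measurable_pi_iff.2 fun d => Measurable.max (by fun_prop) (by fun_prop)
  · fun_prop
  · fun_prop

theorem measurable_newParent (lam : ℝ) (k : ℕ) (z : Fin D → ℝ) {T : α → MTree D} {t : α → ℝ}
    {c : α → Fin D × ℝ} (hT : Measurable T) (ht : Measurable t) (hc : Measurable c) :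
    Measurable fun a => newParent lam k z (T a) (t a) (c a) := by
  have hcard : Measurable fun a => (T a).root.idx.card :=
    (measurable_of_countable fun s : Finset ℕ => s.card).comp
      (measurable_idx.comp (measurable_root.comp hT))
  have ha : Measurable fun a => ({ (T a).root.add k z with time := t a } : NodeData D) := by
    have h : Measurable fun a => (T a).root.add k z := by fun_prop
    exact measurable_nodeData_mk (measurable_idx.comp h) (measurable_lo.comp h)
      (measurable_hi.comp h) ht (measurable_obs.comp h)
  unfold newParent
  refine Measurable.ite (measurableSet_lt (by fun_prop) (by fun_prop)) ?_ ?_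
  · exact measurable_node ha (by fun_prop) hT measurable_const
  · exact measurable_node ha (by fun_prop) measurable_const hT

end

/-! ### Measures depending measurably on a parameter -/

section Measures

variable {α Ω : Type*} [MeasurableSpace α] [MeasurableSpace Ω]

/-- Reduces measurability of a kernel to that of its integrals, for which explicit formulas are
available below. -/
theorem measurable_measure_of_lintegral {μ : α → Measure Ω}
    (h : ∀ f : Ω → ENNReal, Measurable f → Measurable fun a => ∫⁻ ω, f ω ∂μ a) :
    Measurable μ := by
  refine Measure.measurable_of_measurable_coe _ fun A hA => ?_
  have := h (A.indicator 1) (measurable_one.indicator hA)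
  simpa only [lintegral_indicator_one hA] using this

theorem measurable_lintegral_measure {μ : α → Measure Ω} (hμ : Measurable μ) {f : Ω → ENNReal}
    (hf : Measurable f) : Measurable fun a => ∫⁻ ω, f ω ∂μ a :=
  (Measure.measurable_lintegral hf).comp hμ

theorem measurable_lintegral_measure_prod {μ : α → Measure Ω} (hμ : Measurable μ)
    [∀ a, IsProbabilityMeasure (μ a)] {f : α × Ω → ENNReal} (hf : Measurable f) :
    Measurable fun a => ∫⁻ ω, f (a, ω) ∂μ a := by
  let κ : Kernel α Ω := ⟨μ, hμ⟩
  have : IsMarkovKernel κ := ⟨fun a => inferInstanceAs (IsProbabilityMeasure (μ a))⟩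
  exact Measurable.lintegral_kernel_prod_right (κ := κ) (f := fun a ω => f (a, ω)) hf

theorem lintegral_bind_of_measurable {m : Measure α} {μ : α → Measure Ω} (hμ : Measurable μ)
    {f : Ω → ENNReal} (hf : Measurable f) :
    ∫⁻ ω, f ω ∂m.bind μ = ∫⁻ a, ∫⁻ ω, f ω ∂μ a ∂m :=
  Measure.lintegral_bind hμ.aemeasurable hf.aemeasurable

theorem measure_ext_of_lintegral {μ ν : Measure Ω}
    (h : ∀ f : Ω → ENNReal, Measurable f → ∫⁻ ω, f ω ∂μ = ∫⁻ ω, f ω ∂ν) : μ = ν := by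
  ext A hA
  simpa only [lintegral_indicator_one hA] using h (A.indicator 1) (measurable_one.indicator hA)

end Measures

/-! ### Waiting for an exponential time -/

section Waiting

variable {Ω : Type*} [MeasurableSpace Ω]

open Classical in
/-- Wait for an exponential time of rate `r` (infinite for `r = 0`) from time `s` on; sample from
`J t` if the wait ends at a time `t < τ`, and from `h` otherwise. -/
def waitLaw (r s τ : ℝ) (J : ℝ → Measure Ω) (h : Measure Ω) : Measure Ω :=
  if r = 0 then h else (expMeasure r).bind fun E => if s + E < τ then J (s + E) else h

theorem measurable_wait (s τ : ℝ) {J : ℝ → Measure Ω} (hJ : Measurable J) (h : Measure Ω) :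
    Measurable fun E => if s + E < τ then J (s + E) else h :=
  Measurable.ite (measurableSet_lt (by fun_prop) (by fun_prop)) (hJ.comp (by fun_prop))
    measurable_const

theorem isProbabilityMeasure_waitLaw {r : ℝ} (hr : 0 ≤ r) (s τ : ℝ) {J : ℝ → Measure Ω}
    (hJ : Measurable J) (h : Measure Ω) [IsProbabilityMeasure h]
    (hJ' : r ≠ 0 → ∀ t, IsProbabilityMeasure (J t)) :
    IsProbabilityMeasure (waitLaw r s τ J h) := by
  unfold waitLaw
  split_ifs with h0
  · infer_instance
  · have := isProbabilityMeasure_expMeasure (lt_of_le_of_ne hr (Ne.symm h0))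
    refine isProbabilityMeasure_bind (measurable_wait s τ hJ h).aemeasurable
      (Filter.Eventually.of_forall fun E => ?_)
    split_ifs
    exacts [hJ' h0 _, inferInstance]

/-- The truncation at 0 reflects that the waiting time is nonnegative: the tail is 1 for negative
`x`. -/
theorem expMeasure_Ici {r : ℝ} (hr : 0 < r) (x : ℝ) :
    expMeasure r (Set.Ici x) = ENNReal.ofReal (Real.exp (-(r * max x 0))) := by
  have := isProbabilityMeasure_expMeasure hr
  have hIic : expMeasure r (Set.Iio x) =
      ENNReal.ofReal (if 0 ≤ x then 1 - Real.exp (-(r * x)) else 0) := by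
    rw [← lintegral_exponentialPDF_eq_antiDeriv hr x, ← setLIntegral_congr Iio_ae_eq_Iic]
    exact withDensity_apply _ measurableSet_Iio
  rw [← Set.compl_Iio, prob_compl_eq_one_sub measurableSet_Iio, hIic,
    ← ENNReal.ofReal_one, ← ENNReal.ofReal_sub]
  · congr 1
    split_ifs with hx
    · rw [max_eq_left hx]
      ring
    · rw [max_eq_right (not_le.1 hx).le]
      simp
  · split_ifs with hx
    · have : Real.exp (-(r * x)) ≤ 1 := Real.exp_le_one_iff.2 (by nlinarith)
      linarith
    · exact le_rfl

/-- The integral splits according to whether the wait outlasts `τ - s`. For `r = 0` the density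
vanishes and the survival factor is 1; for `τ < s` the interval is empty and the truncated exponent
is 0, so both degenerate cases fit the same formula. -/
theorem lintegral_waitLaw {r : ℝ} (hr : 0 ≤ r) (s τ : ℝ) {J : ℝ → Measure Ω} (hJ : Measurable J)
    (h : Measure Ω) {f : Ω → ENNReal} (hf : Measurable f) :
    ∫⁻ ω, f ω ∂waitLaw r s τ J h =
      ENNReal.ofReal (Real.exp (-(r * max (τ - s) 0))) * ∫⁻ ω, f ω ∂h +
      ∫⁻ t in Set.Ico s τ, ENNReal.ofReal (r * Real.exp (-(r * (t - s)))) * ∫⁻ ω, f ω ∂J t := by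
  unfold waitLaw
  split_ifs with h0
  · simp [h0]
  have hr0 : 0 < r := lt_of_le_of_ne hr (Ne.symm h0)
  have := isProbabilityMeasure_expMeasure hr0
  rw [lintegral_bind_of_measurable (measurable_wait s τ hJ h) hf]
  have hS : MeasurableSet {E : ℝ | τ - s ≤ E} := measurableSet_Ici
  rw [← lintegral_add_compl _ hS]
  congr 1
  · rw [setLIntegral_congr_fun (g := fun _ => ∫⁻ ω, f ω ∂h) hS]
    · rw [setLIntegral_const, mul_comm]
      congr 1
      exact expMeasure_Ici hr0 _
    · intro E hE
      have : ¬ s + E < τ := by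
        simp only [Set.mem_ofPred_eq] at hE
        linarith
      simp [this]
  · have hF : Measurable fun t => ∫⁻ ω, f ω ∂J t := measurable_lintegral_measure hJ hf
    rw [setLIntegral_congr_fun (g := fun E => ∫⁻ ω, f ω ∂J (s + E)) hS.compl]
    · rw [← lintegral_indicator hS.compl]
      have hm : Measurable ({E : ℝ | τ - s ≤ E}ᶜ.indicator fun E => ∫⁻ ω, f ω ∂J (s + E)) :=
        (hF.comp (by fun_prop)).indicator hS.compl
      change ∫⁻ E, _ ∂(volume.withDensity (exponentialPDF r)) = _
      -- Translation invariance of Lebesgue measure passes from the waiting time `E` to the absolute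
      -- time `s + E`.
      rw [lintegral_withDensity_eq_lintegral_mul _ (by
        exact ENNReal.measurable_ofReal.comp (measurable_exponentialPDFReal r)) hm,
        ← lintegral_indicator measurableSet_Ico,
        ← lintegral_add_left_eq_self (fun t => (Set.Ico s τ).indicator _ t) s]
      refine lintegral_congr fun E => ?_
      simp only [Pi.mul_apply, Set.indicator_apply, Set.mem_compl_iff, Set.mem_ofPred_eq,
        Set.mem_Ico, not_le, exponentialPDF_eq, add_sub_cancel_left, le_add_iff_nonneg_right]
      by_cases h1 : 0 ≤ E <;> by_cases h2 : E < τ - s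
      · simp [h1, h2, show s + E < τ by linarith]
      · simp [h1, h2, show ¬ s + E < τ by intro _; apply h2; linarith]
      · simp [h1]
      · simp [h1]
    · intro E hE
      have : s + E < τ := by
        simp only [Set.mem_compl_iff, Set.mem_ofPred_eq, not_le] at hE
        linarith
      simp [this]

end Waiting

/-! ### Cuts -/

section Cuts

variable {D : ℕ}

/-- The law of a random cut multiplied by the total weight. -/
def cutMeas (w a b : Fin D → ℝ) : Measure (Fin D × ℝ) :=
  ∑ d, ENNReal.ofReal (w d) • (cond volume (Set.Icc (a d) (b d))).map (Prod.mk d)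

theorem cutLaw_eq {w : Fin D → ℝ} (hw : 0 < ∑ d, w d) (a b : Fin D → ℝ) :
    cutLaw w a b = (ENNReal.ofReal (∑ d, w d))⁻¹ • cutMeas w a b := by
  unfold cutLaw cutMeas
  rw [Finset.smul_sum]
  refine Finset.sum_congr rfl fun d _ => ?_
  rw [smul_smul, ENNReal.ofReal_div_of_pos hw, ENNReal.div_eq_inv_mul]

theorem lintegral_cutMeas (w a b : Fin D → ℝ) {f : Fin D × ℝ → ENNReal} (hf : Measurable f) :
    ∫⁻ c, f c ∂cutMeas w a b = ∑ d, ENNReal.ofReal (w d) *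
      ((ENNReal.ofReal (b d - a d))⁻¹ * ∫⁻ ξ in Set.Icc (a d) (b d), f (d, ξ)) := by
  unfold cutMeas
  rw [lintegral_finsetSum_measure]
  refine Finset.sum_congr rfl fun d _ => ?_
  rw [lintegral_smul_measure, lintegral_map hf measurable_prodMk_left, ProbabilityTheory.cond,
    lintegral_smul_measure, Real.volume_Icc]
  rfl

instance isFiniteMeasure_cutMeas (w a b : Fin D → ℝ) : IsFiniteMeasure (cutMeas w a b) := by
  refine ⟨?_⟩
  unfold cutMeas
  rw [Measure.finsetSum_apply]
  refine ENNReal.sum_lt_top.2 fun d _ => ?_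
  rw [Measure.smul_apply]
  exact ENNReal.mul_lt_top ENNReal.ofReal_lt_top (measure_lt_top _ _)

/-- Dimensions of weight zero contribute nothing, so only those of positive weight need a
nondegenerate interval. -/
theorem isProbabilityMeasure_cutLaw {w a b : Fin D → ℝ} (hw0 : ∀ d, 0 ≤ w d)
    (hw : ∑ d, w d ≠ 0) (hab : ∀ d, 0 < w d → a d < b d) :
    IsProbabilityMeasure (cutLaw w a b) := by
  have hs : 0 < ∑ d, w d := lt_of_le_of_ne (Finset.sum_nonneg fun d _ => hw0 d) (Ne.symm hw)
  refine ⟨?_⟩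
  rw [cutLaw_eq hs, Measure.smul_apply, smul_eq_mul]
  have : cutMeas w a b Set.univ = ENNReal.ofReal (∑ d, w d) := by
    rw [← lintegral_one, lintegral_cutMeas _ _ _ measurable_const,
      ENNReal.ofReal_sum_of_nonneg fun d _ => hw0 d]
    refine Finset.sum_congr rfl fun d _ => ?_
    rcases (hw0 d).eq_or_lt with h | h
    · simp [← h]
    · have h1 := sub_pos.2 (hab d h)
      simp only [lintegral_one, Measure.restrict_apply_univ, Real.volume_Icc]
      rw [ENNReal.inv_mul_cancel (by simpa using h1) ENNReal.ofReal_ne_top, mul_one]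
  rw [this]
  exact ENNReal.inv_mul_cancel (by simpa using hs) ENNReal.ofReal_ne_top

/-- Endpoints are Lebesgue-null. This disposes of cuts through the boundary of a box and of ties
with the new observation. -/
theorem ae_cutMeas_mem_Ioo (w a b : Fin D → ℝ) :
    ∀ᵐ c ∂cutMeas w a b, a c.1 < c.2 ∧ c.2 < b c.1 := by
  have hS : MeasurableSet {c : Fin D × ℝ | a c.1 < c.2 ∧ c.2 < b c.1} :=
    (measurableSet_lt ((measurable_of_countable a).comp measurable_fst) measurable_snd).inter
      (measurableSet_lt measurable_snd ((measurable_of_countable b).comp measurable_fst))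
  rw [ae_iff]
  change cutMeas w a b {c : Fin D × ℝ | a c.1 < c.2 ∧ c.2 < b c.1}ᶜ = 0
  rw [← lintegral_indicator_one hS.compl,
    lintegral_cutMeas _ _ _ (measurable_one.indicator hS.compl)]
  refine Finset.sum_eq_zero fun d _ => ?_
  rw [← setLIntegral_congr Ioo_ae_eq_Icc, setLIntegral_congr_fun (g := 0) measurableSet_Ioo]
  · simp
  · intro ξ hξ
    simpa [Set.indicator_apply] using ⟨hξ.1, hξ.2⟩

/-- A weight equal to the length undoes the normalisation of the uniform law. If the interval is
empty or a point, both sides vanish. -/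
theorem cond_smul_eq_restrict {w a b : ℝ} (h : w = max (b - a) 0) :
    ENNReal.ofReal w • cond volume (Set.Icc a b) = volume.restrict (Set.Icc a b) := by
  unfold ProbabilityTheory.cond
  rw [smul_smul, Real.volume_Icc]
  rcases le_or_gt b a with hab | hab
  · have h0 : volume (Set.Icc a b) = 0 := by simp [hab]
    rw [Measure.restrict_eq_zero.2 h0, smul_zero]
  · rw [h, max_eq_left (sub_pos.2 hab).le, ENNReal.mul_inv_cancel (by simpa using hab)
      ENNReal.ofReal_ne_top, one_smul]

theorem restrict_Icc_extend {l u : ℝ} (hlu : l ≤ u) (z : ℝ) :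
    volume.restrict (Set.Icc (min l z) (max u z)) = volume.restrict (Set.Icc l u) +
      volume.restrict (Set.Icc (if u < z then u else z) (if u < z then z else l)) := by
  have key : ∀ {p q r : ℝ}, p ≤ q → q ≤ r → volume.restrict (Set.Icc p r) =
      volume.restrict (Set.Icc p q) + volume.restrict (Set.Icc q r) := by
    intro p q r hpq hqr
    rw [← Set.Icc_union_Icc_eq_Icc hpq hqr, Measure.restrict_union₀ _
      measurableSet_Icc.nullMeasurableSet]
    refine measure_mono_null (t := {q}) ?_ (by simp)
    rintro x ⟨h1, h2⟩
    exact le_antisymm h1.2 h2.1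
  split_ifs with h
  · rw [min_eq_left (hlu.trans h.le), max_eq_right h.le]
    exact key hlu h.le
  · rw [max_eq_left (not_lt.1 h)]
    rcases le_total z l with hz | hz
    · rw [min_eq_right hz, add_comm]
      exact key hz hlu
    -- Here `z` lies in `[l, u]`: nothing is added, and the extension interval is at most a point.
    · have h0 : volume (Set.Icc z l) = 0 := by simp [hz]
      rw [min_eq_left hz, Measure.restrict_eq_zero.2 h0, add_zero]

theorem extLo_add_extHi {l u : ℝ} (hlu : l ≤ u) (z : ℝ) :
    max (l - z) 0 + max (z - u) 0 =
      max ((if u < z then z else l) - (if u < z then u else z)) 0 := by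
  split_ifs with h
  · rw [max_eq_right (a := l - z) (by linarith), zero_add]
  · rw [max_eq_right (a := z - u) (by linarith), add_zero]

theorem max_sub_min_eq {l u : ℝ} (hlu : l ≤ u) (z : ℝ) :
    max u z - min l z = (u - l) + (max (l - z) 0 + max (z - u) 0) := by
  rcases le_total u z with h1 | h1 <;> rcases le_total l z with h2 | h2
  · rw [max_eq_right h1, min_eq_left h2, max_eq_right (by linarith), max_eq_left (by linarith)]
    ring
  · rw [max_eq_right h1, min_eq_right h2, max_eq_left (by linarith), max_eq_left (by linarith)]
    linarith
  · rw [max_eq_left h1, min_eq_left h2, max_eq_right (by linarith), max_eq_right (by linarith)]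
    ring
  · rw [max_eq_left h1, min_eq_right h2, max_eq_left (by linarith), max_eq_right (by linarith)]
    ring

/-- The cuts of an extended box are the cuts of the box and the cuts of the extension. -/
theorem cutMeas_extend {l u : Fin D → ℝ} (hlu : ∀ d, l d ≤ u d) (z : Fin D → ℝ) :
    cutMeas (fun d => max (u d) (z d) - min (l d) (z d)) (fun d => min (l d) (z d))
        (fun d => max (u d) (z d)) =
      cutMeas (fun d => u d - l d) l u +
      cutMeas (fun d => extLo l z d + extHi u z d) (fun d => if u d < z d then u d else z d)
        (fun d => if u d < z d then z d else l d) := by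
  unfold cutMeas
  rw [← Finset.sum_add_distrib]
  refine Finset.sum_congr rfl fun d _ => ?_
  have hle : min (l d) (z d) ≤ max (u d) (z d) :=
    (min_le_left _ _).trans ((hlu d).trans (le_max_left _ _))
  rw [← Measure.map_smul, ← Measure.map_smul, ← Measure.map_smul,
    cond_smul_eq_restrict (max_eq_left (sub_nonneg.2 hle)).symm,
    cond_smul_eq_restrict (max_eq_left (sub_nonneg.2 (hlu d))).symm,
    cond_smul_eq_restrict (w := (fun d => extLo l z d + extHi u z d) d)
      (extLo_add_extHi (hlu d) (z d)),
    restrict_Icc_extend (hlu d), Measure.map_add _ _ measurable_prodMk_left]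

/-! ### Exponential waits followed by a cut -/

variable {Ω : Type*} [MeasurableSpace Ω]

theorem measurable_bind_of_uncurry {α : Type*} [MeasurableSpace α] (m : Measure α) [SFinite m]
    {K : ℝ → α → Measure Ω} (hK : Measurable (Function.uncurry K)) :
    Measurable fun t => m.bind (K t) := by
  refine Measure.measurable_of_measurable_coe _ fun A hA => ?_
  have h : ∀ t, m.bind (K t) A = ∫⁻ c, Function.uncurry K (t, c) A ∂m := fun t =>
    Measure.bind_apply hA (hK.comp measurable_prodMk_left).aemeasurable
  simp only [h]
  exact Measurable.lintegral_prod_right' (f := fun p => Function.uncurry K p A)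
    ((Measure.measurable_coe hA).comp hK)

theorem measurable_cutLaw_bind {w : Fin D → ℝ} (hw : 0 < ∑ d, w d) (a b : Fin D → ℝ)
    {K : ℝ → Fin D × ℝ → Measure Ω} (hK : Measurable (Function.uncurry K)) :
    Measurable fun t => (cutLaw w a b).bind (K t) := by
  rw [cutLaw_eq hw]
  exact measurable_bind_of_uncurry _ hK

theorem isProbabilityMeasure_waitLaw_cut {w a b : Fin D → ℝ} (hw : ∀ d, 0 ≤ w d)
    (hab : ∀ d, 0 < w d → a d < b d) (s τ : ℝ) {K : ℝ → Fin D × ℝ → Measure Ω}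
    (hK : Measurable (Function.uncurry K)) (hK' : ∀ t c, IsProbabilityMeasure (K t c))
    (h : Measure Ω) [IsProbabilityMeasure h] :
    IsProbabilityMeasure (waitLaw (∑ d, w d) s τ (fun t => (cutLaw w a b).bind (K t)) h) := by
  by_cases h0 : ∑ d, w d = 0
  · simpa [waitLaw, h0]
  have hs : 0 < ∑ d, w d := lt_of_le_of_ne (Finset.sum_nonneg fun d _ => hw d) (Ne.symm h0)
  refine isProbabilityMeasure_waitLaw hs.le s τ (measurable_cutLaw_bind hs a b hK) h
    fun _ t => ?_
  have := isProbabilityMeasure_cutLaw hw h0 hab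
  exact isProbabilityMeasure_bind (hK.comp measurable_prodMk_left).aemeasurable
    (Filter.Eventually.of_forall fun c => hK' t c)

/-- The total weight is both the exponential rate and the normaliser of `cutLaw`. Their cancellation
leaves a density without prefactor and a cut measure that is additive in the box. -/
theorem lintegral_waitLaw_cut {w : Fin D → ℝ} (hw : ∀ d, 0 ≤ w d) (a b : Fin D → ℝ) (s τ : ℝ)
    {K : ℝ → Fin D × ℝ → Measure Ω} (hK : Measurable (Function.uncurry K)) (h : Measure Ω)
    {f : Ω → ENNReal} (hf : Measurable f) :
    ∫⁻ ω, f ω ∂waitLaw (∑ d, w d) s τ (fun t => (cutLaw w a b).bind (K t)) h =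
      ENNReal.ofReal (Real.exp (-((∑ d, w d) * max (τ - s) 0))) * ∫⁻ ω, f ω ∂h +
      ∫⁻ t in Set.Ico s τ, ENNReal.ofReal (Real.exp (-((∑ d, w d) * (t - s)))) *
        ∫⁻ c, ∫⁻ ω, f ω ∂K t c ∂cutMeas w a b := by
  by_cases h0 : ∑ d, w d = 0
  · have h1 : ∀ d, w d = 0 := fun d =>
      (Finset.sum_eq_zero_iff_of_nonneg fun d _ => hw d).1 h0 d (Finset.mem_univ d)
    simp [waitLaw, cutMeas, h1]
  have hs : 0 < ∑ d, w d := lt_of_le_of_ne (Finset.sum_nonneg fun d _ => hw d) (Ne.symm h0)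
  rw [lintegral_waitLaw hs.le s τ (measurable_cutLaw_bind hs a b hK) h hf]
  congr 1
  refine lintegral_congr fun t => ?_
  have hKt : Measurable (K t) := hK.comp measurable_prodMk_left
  rw [lintegral_bind_of_measurable hKt hf, cutLaw_eq hs,
    lintegral_smul_measure, ENNReal.ofReal_mul hs.le, smul_eq_mul, mul_comm (ENNReal.ofReal _),
    mul_assoc, ← mul_assoc (ENNReal.ofReal (∑ d, w d)),
    ENNReal.mul_inv_cancel (by simpa using hs) ENNReal.ofReal_ne_top, one_mul]

end Cuts

/-! ### Mondrian blocks -/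

section Parameters

variable {α : Type*} [MeasurableSpace α]

/-- Variable endpoints are absorbed into the indicator of a measurable region in the product. -/
theorem measurable_setLIntegral_Ico {s τ : α → ℝ} (hs : Measurable s) (hτ : Measurable τ)
    {g : α → ℝ → ENNReal} (hg : Measurable (Function.uncurry g)) :
    Measurable fun a => ∫⁻ t in Set.Ico (s a) (τ a), g a t := by
  have hS : MeasurableSet {p : α × ℝ | s p.1 ≤ p.2 ∧ p.2 < τ p.1} :=
    (measurableSet_le (hs.comp measurable_fst) measurable_snd).inter
      (measurableSet_lt measurable_snd (hτ.comp measurable_fst))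
  have := Measurable.lintegral_prod_right' (ν := volume) (hg.indicator hS)
  convert this using 2 with a
  rw [← lintegral_indicator measurableSet_Ico]
  rfl

end Parameters

section Block

variable {D : ℕ}

/-- The law of a tree with independent subtrees of laws `μ` and `ν`. -/
def joinLaw (a : NodeData D) (c : CutData D) (μ ν : Measure (MTree D)) : Measure (MTree D) :=
  (μ.prod ν).map fun T => .node a c T.1 T.2

theorem measurable_node_pair (a : NodeData D) (c : CutData D) :
    Measurable fun T : MTree D × MTree D => MTree.node a c T.1 T.2 := by
  fun_prop

theorem lintegral_joinLaw (a : NodeData D) (c : CutData D) (μ ν : Measure (MTree D)) [SFinite ν]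
    {f : MTree D → ENNReal} (hf : Measurable f) :
    ∫⁻ T, f T ∂joinLaw a c μ ν = ∫⁻ T₀, ∫⁻ T₁, f (.node a c T₀ T₁) ∂ν ∂μ := by
  unfold joinLaw
  rw [lintegral_map hf (measurable_node_pair a c)]
  exact lintegral_prod _ (hf.comp (measurable_node_pair a c)).aemeasurable

instance isProbabilityMeasure_joinLaw (a : NodeData D) (c : CutData D) (μ ν : Measure (MTree D))
    [IsProbabilityMeasure μ] [IsProbabilityMeasure ν] :
    IsProbabilityMeasure (joinLaw a c μ ν) :=
  Measure.isProbabilityMeasure_map (measurable_node_pair a c).aemeasurable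

theorem measurable_joinLaw {α : Type*} [MeasurableSpace α] {a : α → NodeData D}
    {c : α → CutData D} {μ ν : α → Measure (MTree D)} (ha : Measurable a) (hc : Measurable c)
    (hμ : Measurable μ) (hν : Measurable ν) [∀ t, IsProbabilityMeasure (μ t)]
    [∀ t, IsProbabilityMeasure (ν t)] :
    Measurable fun t => joinLaw (a t) (c t) (μ t) (ν t) := by
  refine measurable_measure_of_lintegral fun f hf => ?_
  simp only [lintegral_joinLaw _ _ _ _ hf]
  refine measurable_lintegral_measure_prod hμ
    (f := fun p : α × MTree D => ∫⁻ T₁, f (.node (a p.1) (c p.1) p.2 T₁) ∂ν p.1) ?_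
  have hν' : Measurable fun p : α × MTree D => ν p.1 := hν.comp measurable_fst
  refine measurable_lintegral_measure_prod hν'
    (f := fun q : (α × MTree D) × MTree D => f (.node (a q.1.1) (c q.1.1) q.1.2 q.2)) ?_
  exact hf.comp (by fun_prop)

variable (lam : ℝ) (x : ℕ → Fin D → ℝ) (N : Finset ℕ)

/-- The law of the leaf into which a block without cuts degenerates. -/
def haltLaw : Measure (MTree D) := Measure.dirac (.leaf (freshData x N lam))

instance : IsProbabilityMeasure (haltLaw lam x N) := by
  unfold haltLaw
  infer_instance

open Classical in
/-- The law of a block whose root has time `t` and cut `c`. -/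
def splitLaw (t : ℝ) (c : Fin D × ℝ) : Measure (MTree D) :=
  if (below x N c).card < N.card ∧ (above x N c).card < N.card then
    joinLaw (freshData x N t) ⟨c.1, c.2, (below x N c).card, (above x N c).card⟩
      (block lam x (below x N c) t) (block lam x (above x N c) t)
  else haltLaw lam x N

theorem block_eq (s : ℝ) :
    block lam x N s = waitLaw (∑ d, (upper x N d - lower x N d)) s lam
      (fun t => (cutLaw (fun d => upper x N d - lower x N d) (lower x N) (upper x N)).bind
        (splitLaw lam x N t)) (haltLaw lam x N) := by
  rw [block]
  rfl

theorem lower_le_upper (d : Fin D) : lower x N d ≤ upper x N d := by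
  unfold lower upper
  split_ifs with h
  · obtain ⟨i, hi⟩ := h
    exact (Finset.inf'_le _ hi).trans (Finset.le_sup' (fun i => x i d) hi)
  · exact le_rfl

theorem measurableSet_le_cut (i : ℕ) : MeasurableSet {c : Fin D × ℝ | x i c.1 ≤ c.2} :=
  measurableSet_le ((measurable_of_countable (x i)).comp measurable_fst) measurable_snd

theorem measurable_below : Measurable (below x N) := by
  refine measurable_to_countable' fun A => ?_
  have : below x N ⁻¹' {A} = {c | ∀ i, i ∈ A ↔ i ∈ N ∧ x i c.1 ≤ c.2} := by
    ext c
    simp only [Set.mem_preimage, Set.mem_singleton_iff, Finset.ext_iff, below, Finset.mem_filter,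
      Set.mem_ofPred_eq]
    exact forall_congr' fun i => iff_comm
  rw [this]
  refine measurableSet_setOfPred.2 (Measurable.forall fun i => Measurable.iff measurable_const
    (Measurable.and measurable_const ?_))
  exact measurableSet_setOfPred.1 (measurableSet_le_cut x i)

theorem measurable_above : Measurable (above x N) := by
  refine measurable_to_countable' fun A => ?_
  have : above x N ⁻¹' {A} = {c | ∀ i, i ∈ A ↔ i ∈ N ∧ ¬ x i c.1 ≤ c.2} := by
    ext c
    simp only [Set.mem_preimage, Set.mem_singleton_iff, Finset.ext_iff, above, Finset.mem_filter,
      Set.mem_ofPred_eq, not_le]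
    exact forall_congr' fun i => iff_comm
  rw [this]
  refine measurableSet_setOfPred.2 (Measurable.forall fun i => Measurable.iff measurable_const
    (Measurable.and measurable_const (Measurable.not ?_)))
  exact measurableSet_setOfPred.1 (measurableSet_le_cut x i)

variable {lam x N}

/-- The cut enters the sub-blocks only through the two index sets, which take countably many values.
The hypotheses concern smaller sets only, so that the lemma can serve inside the induction on
cardinality. -/
theorem measurable_splitLaw_of_lt
    (h1 : ∀ M : Finset ℕ, M.card < N.card → ∀ s, IsProbabilityMeasure (block lam x M s))
    (h2 : ∀ M : Finset ℕ, M.card < N.card → Measurable (block lam x M)) :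
    Measurable (Function.uncurry (splitLaw lam x N)) := by
  classical
  -- The index sets are decoupled from the cut, so that measurability can be checked with them
  -- frozen.
  let F : (Finset ℕ × Finset ℕ) × (ℝ × (Fin D × ℝ)) → Measure (MTree D) := fun p =>
    if p.1.1.card < N.card ∧ p.1.2.card < N.card then
      joinLaw (freshData x N p.2.1) ⟨p.2.2.1, p.2.2.2, p.1.1.card, p.1.2.card⟩
        (block lam x p.1.1 p.2.1) (block lam x p.1.2 p.2.1)
    else haltLaw lam x N
  have hF : Measurable F := by
    refine measurable_from_prod_countable_right fun ⟨A, B⟩ => ?_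
    simp only [F]
    by_cases h : A.card < N.card ∧ B.card < N.card
    · simp only [h, and_self, if_true]
      have hA := h1 A h.1
      have hB := h1 B h.2
      refine measurable_joinLaw ?_ (by fun_prop) ((h2 A h.1).comp measurable_fst)
        ((h2 B h.2).comp measurable_fst)
      unfold freshData
      fun_prop
    · simp only [h, if_false]
      exact measurable_const
  have : Function.uncurry (splitLaw lam x N) =
      fun p => F ((below x N p.2, above x N p.2), p) := by
    funext p
    simp only [Function.uncurry, splitLaw, F]
  rw [this]
  exact hF.comp ((((measurable_below x N).comp measurable_snd).prodMk
    ((measurable_above x N).comp measurable_snd)).prodMk measurable_id)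

theorem isProbabilityMeasure_splitLaw_of_lt
    (h1 : ∀ M : Finset ℕ, M.card < N.card → ∀ s, IsProbabilityMeasure (block lam x M s))
    (t : ℝ) (c : Fin D × ℝ) : IsProbabilityMeasure (splitLaw lam x N t c) := by
  unfold splitLaw
  split_ifs with h
  · have := h1 _ h.1 t
    have := h1 _ h.2 t
    infer_instance
  · infer_instance

theorem lintegral_block_of_measurable (h : Measurable (Function.uncurry (splitLaw lam x N)))
    (s : ℝ) {f : MTree D → ENNReal} (hf : Measurable f) :
    ∫⁻ T, f T ∂block lam x N s =
      ENNReal.ofReal (Real.exp (-((∑ d, (upper x N d - lower x N d)) * max (lam - s) 0))) *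
        f (.leaf (freshData x N lam)) +
      ∫⁻ t in Set.Ico s lam,
        ENNReal.ofReal (Real.exp (-((∑ d, (upper x N d - lower x N d)) * (t - s)))) *
          ∫⁻ c, ∫⁻ T, f T ∂splitLaw lam x N t c
            ∂cutMeas (fun d => upper x N d - lower x N d) (lower x N) (upper x N) := by
  rw [block_eq, lintegral_waitLaw_cut (fun d => sub_nonneg.2 (lower_le_upper x N d)) _ _ _ _ h _ hf,
    haltLaw, lintegral_dirac' _ hf]

theorem measurable_lintegral_cutMeas {K : ℝ → Fin D × ℝ → Measure (MTree D)}
    (hK : Measurable (Function.uncurry K)) (w a b : Fin D → ℝ) {f : MTree D → ENNReal}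
    (hf : Measurable f) : Measurable fun t => ∫⁻ c, ∫⁻ T, f T ∂K t c ∂cutMeas w a b :=
  Measurable.lintegral_prod_right' (f := fun p => ∫⁻ T, f T ∂Function.uncurry K p)
    (measurable_lintegral_measure hK hf)

variable (lam x)

/-- The two properties are proved together: measurability of the split law needs both of them for
the smaller blocks. -/
theorem block_probability_and_measurable (n : ℕ) : ∀ M : Finset ℕ, M.card = n →
    (∀ s, IsProbabilityMeasure (block lam x M s)) ∧ Measurable (block lam x M) := by
  induction n using Nat.strong_induction_on with
  | _ n ih =>
    intro M hM
    have h1 : ∀ A : Finset ℕ, A.card < M.card → ∀ s, IsProbabilityMeasure (block lam x A s) :=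
      fun A hA => (ih _ (hM ▸ hA) A rfl).1
    have h2 : ∀ A : Finset ℕ, A.card < M.card → Measurable (block lam x A) :=
      fun A hA => (ih _ (hM ▸ hA) A rfl).2
    have hK := measurable_splitLaw_of_lt h1 h2
    refine ⟨fun s => ?_, measurable_measure_of_lintegral fun f hf => ?_⟩
    · rw [block_eq]
      exact isProbabilityMeasure_waitLaw_cut (fun d => sub_nonneg.2 (lower_le_upper x M d))
        (fun d => sub_pos.1) s lam hK (isProbabilityMeasure_splitLaw_of_lt h1) _
    · simp only [lintegral_block_of_measurable hK _ hf]
      refine Measurable.add (by fun_prop) (measurable_setLIntegral_Ico measurable_id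
        measurable_const ?_)
      exact Measurable.mul (by fun_prop)
        ((measurable_lintegral_cutMeas hK _ _ _ hf).comp measurable_snd)

instance isProbabilityMeasure_block (N : Finset ℕ) (s : ℝ) :
    IsProbabilityMeasure (block lam x N s) :=
  (block_probability_and_measurable lam x _ N rfl).1 s

theorem measurable_block (N : Finset ℕ) : Measurable (block lam x N) :=
  (block_probability_and_measurable lam x _ N rfl).2

theorem measurable_splitLaw (N : Finset ℕ) : Measurable (Function.uncurry (splitLaw lam x N)) :=
  measurable_splitLaw_of_lt (fun M _ => isProbabilityMeasure_block lam x M)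
    fun M _ => measurable_block lam x M

/-- Integration against the law of a block, in terms of the time and the cut at the root. -/
theorem lintegral_block (N : Finset ℕ) (s : ℝ) {f : MTree D → ENNReal} (hf : Measurable f) :
    ∫⁻ T, f T ∂block lam x N s =
      ENNReal.ofReal (Real.exp (-((∑ d, (upper x N d - lower x N d)) * max (lam - s) 0))) *
        f (.leaf (freshData x N lam)) +
      ∫⁻ t in Set.Ico s lam,
        ENNReal.ofReal (Real.exp (-((∑ d, (upper x N d - lower x N d)) * (t - s)))) *
          ∫⁻ c, ∫⁻ T, f T ∂splitLaw lam x N t c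
            ∂cutMeas (fun d => upper x N d - lower x N d) (lower x N) (upper x N) :=
  lintegral_block_of_measurable (measurable_splitLaw lam x N) s hf

theorem lintegral_splitLaw {N : Finset ℕ} {c : Fin D × ℝ} (h0 : (below x N c).card < N.card)
    (h1 : (above x N c).card < N.card) (t : ℝ) {f : MTree D → ENNReal} (hf : Measurable f) :
    ∫⁻ T, f T ∂splitLaw lam x N t c = ∫⁻ T₀, ∫⁻ T₁, f (.node (freshData x N t)
      ⟨c.1, c.2, (below x N c).card, (above x N c).card⟩ T₀ T₁)
      ∂block lam x (above x N c) t ∂block lam x (below x N c) t := by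
  rw [splitLaw, if_pos ⟨h0, h1⟩, lintegral_joinLaw _ _ _ _ hf]

/-- Every branch of the sampling produces a root that is a fresh record of `N` with time at most
`lam`, so agreement on such trees suffices. -/
theorem lintegral_block_congr (N : Finset ℕ) (s : ℝ) {f g : MTree D → ENNReal}
    (hf : Measurable f) (hg : Measurable g)
    (h : ∀ T : MTree D, T.root = freshData x N T.root.time → T.root.time ≤ lam → f T = g T) :
    ∫⁻ T, f T ∂block lam x N s = ∫⁻ T, g T ∂block lam x N s := by
  rw [lintegral_block lam x N s hf, lintegral_block lam x N s hg, h (.leaf _) rfl le_rfl]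
  congr 1
  refine setLIntegral_congr_fun measurableSet_Ico fun t ht => ?_
  congr 1
  refine lintegral_congr fun c => ?_
  by_cases hc : (below x N c).card < N.card ∧ (above x N c).card < N.card
  · rw [lintegral_splitLaw lam x hc.1 hc.2 t hf, lintegral_splitLaw lam x hc.1 hc.2 t hg]
    refine lintegral_congr fun T₀ => lintegral_congr fun T₁ => h _ rfl ht.2.le
  · rw [splitLaw, if_neg hc, haltLaw, lintegral_dirac' _ hf, lintegral_dirac' _ hg]
    exact h _ rfl le_rfl

theorem below_above_nonempty {N : Finset ℕ} {c : Fin D × ℝ}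
    (hc : lower x N c.1 < c.2 ∧ c.2 < upper x N c.1) :
    (below x N c).Nonempty ∧ (above x N c).Nonempty := by
  -- For empty `N` both corners default to 0, and no cut lies strictly between them.
  have hN : N.Nonempty := by
    by_contra hN
    simp only [lower, upper, hN, dite_false] at hc
    exact lt_asymm hc.1 hc.2
  simp only [lower, upper, hN, dite_true, Finset.inf'_lt_iff, Finset.lt_sup'_iff] at hc
  obtain ⟨⟨i, hi, hi'⟩, ⟨j, hj, hj'⟩⟩ := hc
  exact ⟨⟨i, Finset.mem_filter.2 ⟨hi, hi'.le⟩⟩, ⟨j, Finset.mem_filter.2 ⟨hj, hj'⟩⟩⟩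

theorem card_below_add_card_above (N : Finset ℕ) (c : Fin D × ℝ) :
    (below x N c).card + (above x N c).card = N.card := by
  unfold below above
  simp only [← not_le]
  exact Finset.card_filter_add_card_filter_not _

theorem card_below_lt {N : Finset ℕ} {c : Fin D × ℝ} (h : (above x N c).Nonempty) :
    (below x N c).card < N.card := by
  have := card_below_add_card_above x N c
  have := h.card_pos
  omega

theorem card_above_lt {N : Finset ℕ} {c : Fin D × ℝ} (h : (below x N c).Nonempty) :
    (above x N c).card < N.card := by
  have := card_below_add_card_above x N c
  have := h.card_pos
  omega

/-- Memorylessness: a block whose root is later than `t` is a block started at time `t`. -/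
theorem lintegral_block_time (N : Finset ℕ) {s t : ℝ} (hst : s ≤ t) (ht : t < lam)
    {f : MTree D → ENNReal} (hf : Measurable f) :
    ∫⁻ T, (if t < T.root.time then f T else 0) ∂block lam x N s =
      ENNReal.ofReal (Real.exp (-((∑ d, (upper x N d - lower x N d)) * (t - s)))) *
        ∫⁻ T, f T ∂block lam x N t := by
  have hf' : Measurable fun T : MTree D => if t < T.root.time then f T else 0 :=
    Measurable.ite (measurableSet_lt measurable_const (by fun_prop)) hf measurable_const
  rw [lintegral_block lam x N s hf', lintegral_block lam x N t hf, mul_add, ← mul_assoc,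
    ← ENNReal.ofReal_mul (Real.exp_pos _).le, ← Real.exp_add]
  have hroot : (MTree.leaf (freshData x N lam)).root.time = lam := rfl
  rw [hroot, if_pos ht, max_eq_left (by linarith), max_eq_left (by linarith)]
  congr 2
  · ring_nf
  have hm := measurable_lintegral_cutMeas (measurable_splitLaw lam x N)
    (fun d => upper x N d - lower x N d) (lower x N) (upper x N) hf
  -- The restriction to root times after `t` is strict, hence the open interval; the endpoint is
  -- null.
  rw [← lintegral_const_mul _ (by fun_prop), ← setLIntegral_congr (Ioo_ae_eq_Ico (a := t) (b := lam)),
    ← lintegral_indicator measurableSet_Ico, ← lintegral_indicator measurableSet_Ioo]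
  refine lintegral_congr fun u => ?_
  simp only [Set.indicator_apply, Set.mem_Ico, Set.mem_Ioo]
  by_cases hu : t < u
  · by_cases hul : u < lam
    · rw [if_pos ⟨by linarith, hul⟩, if_pos ⟨hu, hul⟩, ← mul_assoc,
        ← ENNReal.ofReal_mul (Real.exp_pos _).le, ← Real.exp_add]
      congr 1
      · ring_nf
      refine lintegral_congr_ae ?_
      filter_upwards [ae_cutMeas_mem_Ioo _ _ _] with c hc
      obtain ⟨h0, h1⟩ := below_above_nonempty x hc
      rw [lintegral_splitLaw lam x (card_below_lt x h1) (card_above_lt x h0) u hf',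
        lintegral_splitLaw lam x (card_below_lt x h1) (card_above_lt x h0) u hf]
      refine lintegral_congr fun T₀ => lintegral_congr fun T₁ => if_pos hu
    · rw [if_neg (by tauto), if_neg (by tauto)]
  · rw [if_neg (c := t < u ∧ u < lam) (by tauto)]
    split_ifs with h
    · rw [lintegral_congr_ae (g := fun _ => 0), lintegral_zero, mul_zero]
      filter_upwards [ae_cutMeas_mem_Ioo _ _ _] with c hc
      obtain ⟨h0, h1⟩ := below_above_nonempty x hc
      rw [lintegral_splitLaw lam x (card_below_lt x h1) (card_above_lt x h0) u hf']
      simp [MTree.root, freshData, hu]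
    · rfl

end Block

/-! ### Insertion -/

section Insertion

variable {D : ℕ}

/-- The weights of the cuts separating `z` from the box `[l, u]`. -/
def extLen (l u z : Fin D → ℝ) (d : Fin D) : ℝ := extLo l z d + extHi u z d

/-- The lower ends of the intervals of cuts separating `z` from the box `[l, u]`. -/
def extStart (u z : Fin D → ℝ) (d : Fin D) : ℝ := if u d < z d then u d else z d

/-- The upper ends of the intervals of cuts separating `z` from the box `[l, u]`. -/
def extStop (l u z : Fin D → ℝ) (d : Fin D) : ℝ := if u d < z d then z d else l d

theorem extLen_nonneg (l u z : Fin D → ℝ) (d : Fin D) : 0 ≤ extLen l u z d :=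
  add_nonneg (le_max_right _ _) (le_max_right _ _)

/-- No order between `l` and `u` is assumed, so insertion has total mass 1 even on trees with
arbitrary stored corners. -/
theorem extStart_lt_extStop {l u z : Fin D → ℝ} {d : Fin D} (h : 0 < extLen l u z d) :
    extStart u z d < extStop l u z d := by
  unfold extStart extStop
  split_ifs with h1
  · exact h1
  · by_contra h2
    simp only [extLen, extLo, extHi] at h
    rw [max_eq_right (by linarith), max_eq_right (by linarith)] at h
    linarith

variable (lam : ℝ) (k : ℕ) (z : Fin D → ℝ)

theorem measurable_dirac_newParent (T : MTree D) :
    Measurable (Function.uncurry fun (t : ℝ) (c : Fin D × ℝ) =>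
      Measure.dirac (newParent lam k z T t c)) :=
  Measure.measurable_dirac.comp
    (measurable_newParent lam k z measurable_const measurable_fst measurable_snd)

/-- Writing the pushforward as a bind with Dirac kernels brings insertion under the same
wait-and-cut formulas as blocks. -/
theorem insertStep_eq (T : MTree D) (s : ℝ) (stay : Measure (MTree D)) :
    insertStep lam k z T s stay =
      waitLaw (∑ d, extLen T.root.lo T.root.hi z d) s T.root.time
        (fun t => (cutLaw (extLen T.root.lo T.root.hi z) (extStart T.root.hi z)
          (extStop T.root.lo T.root.hi z)).bind
            fun c => Measure.dirac (newParent lam k z T t c)) stay := by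
  have h : ∀ t, Measurable (newParent lam k z T t) := fun t =>
    measurable_newParent lam k z measurable_const measurable_const measurable_id
  simp only [fun t m => Measure.bind_dirac_eq_map m (h t)]
  rfl

theorem lintegral_insertStep (T : MTree D) (s : ℝ) (stay : Measure (MTree D))
    {f : MTree D → ENNReal} (hf : Measurable f) :
    ∫⁻ T', f T' ∂insertStep lam k z T s stay =
      ENNReal.ofReal (Real.exp (-((∑ d, extLen T.root.lo T.root.hi z d) *
        max (T.root.time - s) 0))) * ∫⁻ T', f T' ∂stay +
      ∫⁻ t in Set.Ico s T.root.time, ENNReal.ofReal (Real.exp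
        (-((∑ d, extLen T.root.lo T.root.hi z d) * (t - s)))) *
          ∫⁻ c, f (newParent lam k z T t c) ∂cutMeas (extLen T.root.lo T.root.hi z)
            (extStart T.root.hi z) (extStop T.root.lo T.root.hi z) := by
  rw [insertStep_eq, lintegral_waitLaw_cut (extLen_nonneg _ _ z) _ _ _ _
    (measurable_dirac_newParent lam k z T) _ hf]
  simp only [lintegral_dirac' _ hf]

instance isProbabilityMeasure_insertStep (T : MTree D) (s : ℝ) (stay : Measure (MTree D))
    [IsProbabilityMeasure stay] : IsProbabilityMeasure (insertStep lam k z T s stay) := by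
  rw [insertStep_eq]
  exact isProbabilityMeasure_waitLaw_cut (extLen_nonneg _ _ z) (fun d => extStart_lt_extStop) s _
    (measurable_dirac_newParent lam k z T) (fun _ _ => inferInstance) stay

instance isProbabilityMeasure_insertBlock (T : MTree D) (s : ℝ) :
    IsProbabilityMeasure (insertBlock lam k z T s) := by
  induction T generalizing s with
  | leaf a =>
    rw [insertBlock]
    infer_instance
  | node a c L R ihL ihR =>
    rw [insertBlock]
    have := ihL a.time
    have := ihR a.time
    split_ifs
    · have := Measure.isProbabilityMeasure_map (μ := insertBlock lam k z L a.time)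
        (f := fun L' => MTree.node (a.add k z) { c with cnt0 := c.cnt0 + 1 } L' R)
        (by fun_prop)
      infer_instance
    · have := Measure.isProbabilityMeasure_map (μ := insertBlock lam k z R a.time)
        (f := fun R' => MTree.node (a.add k z) { c with cnt1 := c.cnt1 + 1 } L R')
        (by fun_prop)
      infer_instance

/-! ### Measurability of the insertion step in the tree -/

section Measurability

variable {α : Type*} [MeasurableSpace α]

theorem measurable_extLen {l u : α → Fin D → ℝ} (hl : Measurable l) (hu : Measurable u)
    (d : Fin D) : Measurable fun a => extLen (l a) (u a) z d := by
  unfold extLen extLo extHi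
  exact (Measurable.max (by fun_prop) measurable_const).add
    (Measurable.max (by fun_prop) measurable_const)

theorem measurable_extStart {u : α → Fin D → ℝ} (hu : Measurable u) (d : Fin D) :
    Measurable fun a => extStart (u a) z d :=
  Measurable.ite (measurableSet_lt (by fun_prop) measurable_const) (by fun_prop) measurable_const

theorem measurable_extStop {l u : α → Fin D → ℝ} (hl : Measurable l) (hu : Measurable u)
    (d : Fin D) : Measurable fun a => extStop (l a) (u a) z d :=
  Measurable.ite (measurableSet_lt (by fun_prop) measurable_const) measurable_const (by fun_prop)

/-- The cut measure itself varies with the stored box, so the integral is unfolded into finitely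
many Lebesgue integrals with measurable endpoints. -/
theorem measurable_lintegral_newParent {T : α → MTree D} (hT : Measurable T) {t : α → ℝ}
    (ht : Measurable t) {f : MTree D → ENNReal} (hf : Measurable f) :
    Measurable fun a => ∫⁻ c, f (newParent lam k z (T a) (t a) c) ∂cutMeas
      (extLen (T a).root.lo (T a).root.hi z) (extStart (T a).root.hi z)
      (extStop (T a).root.lo (T a).root.hi z) := by
  have hl := measurable_lo.comp (measurable_root.comp hT)
  have hu := measurable_hi.comp (measurable_root.comp hT)
  have h : ∀ a, Measurable fun c => f (newParent lam k z (T a) (t a) c) := fun a =>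
    hf.comp (measurable_newParent lam k z measurable_const measurable_const measurable_id)
  simp only [fun a => lintegral_cutMeas (extLen (T a).root.lo (T a).root.hi z)
    (extStart (T a).root.hi z) (extStop (T a).root.lo (T a).root.hi z) (h a),
    ← setLIntegral_congr Ico_ae_eq_Icc]
  refine Finset.measurable_sum _ fun d _ => ?_
  have ha := measurable_extStart z hu d
  have hb := measurable_extStop z hl hu d
  refine (ENNReal.measurable_ofReal.comp (measurable_extLen z hl hu d)).mul
    ((ENNReal.measurable_ofReal.comp (hb.sub ha)).inv.mul (measurable_setLIntegral_Ico ha hb ?_))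
  exact hf.comp (measurable_newParent lam k z (hT.comp measurable_fst) (ht.comp measurable_fst)
    (measurable_const.prodMk measurable_snd))

theorem measurable_insertStep {T : α → MTree D} (hT : Measurable T) {s : α → ℝ}
    (hs : Measurable s) {stay : α → Measure (MTree D)} (hstay : Measurable stay) :
    Measurable fun a => insertStep lam k z (T a) (s a) (stay a) := by
  refine measurable_measure_of_lintegral fun f hf => ?_
  simp only [lintegral_insertStep lam k z _ _ _ hf]
  have hl := measurable_lo.comp (measurable_root.comp hT)
  have hu := measurable_hi.comp (measurable_root.comp hT)
  have hτ := measurable_time.comp (measurable_root.comp hT)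
  have hr : Measurable fun a => ∑ d, extLen (T a).root.lo (T a).root.hi z d :=
    Finset.measurable_sum _ fun d _ => measurable_extLen z hl hu d
  refine Measurable.add (Measurable.mul ?_ (measurable_lintegral_measure hstay hf))
    (measurable_setLIntegral_Ico hs hτ (Measurable.mul ?_ ?_))
  · exact (Real.measurable_exp.comp
      (hr.mul ((hτ.sub hs).max measurable_const)).neg).ennreal_ofReal
  · exact (Real.measurable_exp.comp ((hr.comp measurable_fst).mul
      (measurable_snd.sub (hs.comp measurable_fst))).neg).ennreal_ofReal
  · exact measurable_lintegral_newParent lam k z (hT.comp measurable_fst) measurable_snd hf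

theorem measurable_map_param {μ : α → Measure (MTree D)} (hμ : Measurable μ)
    [∀ a, IsProbabilityMeasure (μ a)] {g : α → MTree D → MTree D}
    (hg : Measurable (Function.uncurry g)) : Measurable fun a => (μ a).map (g a) := by
  refine measurable_measure_of_lintegral fun f hf => ?_
  simp only [fun a => lintegral_map (μ := μ a) hf
    (show Measurable (g a) from hg.comp measurable_prodMk_left)]
  exact measurable_lintegral_measure_prod hμ (hf.comp hg)

end Measurability

/-- The law of the continued insertion at a node, in terms of the law `F` of the insertion into
its subtrees. -/
def stayLaw (F : MTree D × ℝ → Measure (MTree D)) (a : NodeData D) (c : CutData D)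
    (L R : MTree D) : Measure (MTree D) :=
  if z c.dim ≤ c.loc then
    (F (L, a.time)).map fun L' => .node (a.add k z) { c with cnt0 := c.cnt0 + 1 } L' R
  else (F (R, a.time)).map fun R' => .node (a.add k z) { c with cnt1 := c.cnt1 + 1 } L R'

theorem measurable_stayLaw {F : MTree D × ℝ → Measure (MTree D)} (hF : Measurable F)
    [∀ p, IsProbabilityMeasure (F p)] :
    Measurable fun q : NodeData D × CutData D × MTree D × MTree D =>
      stayLaw k z F q.1 q.2.1 q.2.2.1 q.2.2.2 := by
  have hz : Measurable fun q : NodeData D × CutData D × MTree D × MTree D => z q.2.1.dim :=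
    (measurable_of_countable z).comp (by fun_prop)
  unfold stayLaw
  refine Measurable.ite (measurableSet_le hz (by fun_prop)) ?_ ?_
  · exact measurable_map_param (μ := fun q : NodeData D × CutData D × MTree D × MTree D =>
      F (q.2.2.1, q.1.time)) (hF.comp (by fun_prop)) (by unfold Function.uncurry; fun_prop)
  · exact measurable_map_param (μ := fun q : NodeData D × CutData D × MTree D × MTree D =>
      F (q.2.2.2, q.1.time)) (hF.comp (by fun_prop)) (by unfold Function.uncurry; fun_prop)

instance isProbabilityMeasure_stayLaw (F : MTree D × ℝ → Measure (MTree D))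
    [∀ p, IsProbabilityMeasure (F p)] (a : NodeData D) (c : CutData D) (L R : MTree D) :
    IsProbabilityMeasure (stayLaw k z F a c L R) := by
  unfold stayLaw
  split_ifs
  · exact Measure.isProbabilityMeasure_map (by fun_prop)
  · exact Measure.isProbabilityMeasure_map (by fun_prop)

/-- The number of levels of a tree. -/
def MTree.height : MTree D → ℕ
  | .leaf _ => 1
  | .node _ _ L R => max L.height R.height + 1

/-- The insertion into trees of height at most `n`; it returns a fixed tree if the height is
larger. -/
def insertUpTo : ℕ → MTree D → ℝ → Measure (MTree D)
  | 0, _, _ => Measure.dirac (.leaf ⟨∅, 0, 0, 0, 0⟩)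
  | _ + 1, .leaf a, s => insertStep lam k z (.leaf a) s (Measure.dirac (.leaf (a.add k z)))
  | n + 1, .node a c L R, s => insertStep lam k z (.node a c L R) s
      (stayLaw k z (fun p => insertUpTo n p.1 p.2) a c L R)

instance isProbabilityMeasure_insertUpTo (n : ℕ) (T : MTree D) (s : ℝ) :
    IsProbabilityMeasure (insertUpTo lam k z n T s) := by
  induction n generalizing T s with
  | zero =>
    rw [insertUpTo]
    infer_instance
  | succ n ih =>
    have : ∀ p : MTree D × ℝ, IsProbabilityMeasure (insertUpTo lam k z n p.1 p.2) :=
      fun p => ih _ _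
    cases T <;> (rw [insertUpTo]; infer_instance)

theorem measurable_insertUpTo (n : ℕ) :
    Measurable fun p : MTree D × ℝ => insertUpTo lam k z n p.1 p.2 := by
  induction n with
  | zero =>
    simp only [insertUpTo]
    exact measurable_const
  | succ n ih =>
    refine measurable_mtree_cases (g := insertUpTo lam k z (n + 1)) ?_ ?_
    · simp only [insertUpTo]
      exact measurable_insertStep lam k z (by fun_prop) measurable_snd
        (Measure.measurable_dirac.comp (by fun_prop))
    · simp only [insertUpTo]
      exact measurable_insertStep lam k z (by fun_prop) measurable_snd
        ((measurable_stayLaw k z ih).comp measurable_fst)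

theorem insertUpTo_eq {n : ℕ} {T : MTree D} (hT : T.height ≤ n) (s : ℝ) :
    insertUpTo lam k z n T s = insertBlock lam k z T s := by
  induction T generalizing n s with
  | leaf a =>
    cases n with
    | zero => simp [MTree.height] at hT
    | succ n => rfl
  | node a c L R ihL ihR =>
    cases n with
    | zero => simp [MTree.height] at hT
    | succ n =>
      simp only [MTree.height, Nat.add_le_add_iff_right, sup_le_iff] at hT
      rw [insertUpTo, insertBlock, stayLaw, ihL hT.1, ihR hT.2]

/-- Insertion recurses to a depth unbounded over all trees. On each tree the truncations
`insertUpTo` are eventually equal to it, so it is a pointwise limit of measurable kernels. -/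
theorem measurable_insertBlock :
    Measurable fun p : MTree D × ℝ => insertBlock lam k z p.1 p.2 := by
  refine Measure.measurable_of_measurable_coe _ fun A hA => ?_
  refine measurable_of_tendsto_metrizable (f := fun n p => insertUpTo lam k z n p.1 p.2 A)
    (fun n => (Measure.measurable_coe hA).comp (measurable_insertUpTo lam k z n))
    (tendsto_pi_nhds.2 fun p => ?_)
  refine tendsto_const_nhds.congr' ?_
  filter_upwards [Filter.eventually_ge_atTop p.1.height] with n hn
  rw [insertUpTo_eq lam k z hn]

theorem measurable_insertBlock_left (s : ℝ) :
    Measurable fun T : MTree D => insertBlock lam k z T s :=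
  (measurable_insertBlock lam k z).comp (f := fun T => (T, s)) (by fun_prop)

end Insertion

/-! ### Consistency of insertion with the Mondrian law -/

section Consistency

variable {D : ℕ} (lam : ℝ) (x : ℕ → Fin D → ℝ) {N : Finset ℕ} {k : ℕ}

/-- Nonemptiness keeps the default corner 0 of the empty set out of the minimum. -/
theorem lower_insert (hN : N.Nonempty) (d : Fin D) :
    lower x (insert k N) d = min (lower x N d) (x k d) := by
  simp only [lower, hN, Finset.insert_nonempty, dite_true, Finset.inf'_insert hN]
  exact min_comm _ _

theorem upper_insert (hN : N.Nonempty) (d : Fin D) :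
    upper x (insert k N) d = max (upper x N d) (x k d) := by
  simp only [upper, hN, Finset.insert_nonempty, dite_true, Finset.sup'_insert hN]
  exact max_comm _ _

theorem freshData_add (hN : N.Nonempty) (hk : k ∉ N) (t : ℝ) :
    (freshData x N t).add k (x k) = freshData x (insert k N) t := by
  simp only [NodeData.add, freshData, Finset.card_insert_of_notMem hk, NodeData.mk.injEq,
    true_and, and_true]
  exact ⟨funext fun d => (lower_insert x hN d).symm, funext fun d => (upper_insert x hN d).symm⟩

theorem sum_length_insert (hN : N.Nonempty) :
    ∑ d, (upper x (insert k N) d - lower x (insert k N) d) =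
      ∑ d, (upper x N d - lower x N d) + ∑ d, extLen (lower x N) (upper x N) (x k) d := by
  rw [← Finset.sum_add_distrib]
  refine Finset.sum_congr rfl fun d _ => ?_
  rw [lower_insert x hN, upper_insert x hN]
  exact max_sub_min_eq (lower_le_upper x N d) _

theorem cutMeas_insert (hN : N.Nonempty) :
    cutMeas (fun d => upper x (insert k N) d - lower x (insert k N) d) (lower x (insert k N))
        (upper x (insert k N)) =
      cutMeas (fun d => upper x N d - lower x N d) (lower x N) (upper x N) +
      cutMeas (extLen (lower x N) (upper x N) (x k)) (extStart (upper x N) (x k))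
        (extStop (lower x N) (upper x N) (x k)) := by
  rw [funext (lower_insert x (k := k) hN), funext (upper_insert x (k := k) hN)]
  exact cutMeas_extend (lower_le_upper x N) (x k)

theorem below_insert_of_le {c : Fin D × ℝ} (h : x k c.1 ≤ c.2) :
    below x (insert k N) c = insert k (below x N c) := by
  rw [below, Finset.filter_insert, if_pos h, below]

theorem below_insert_of_lt {c : Fin D × ℝ} (h : c.2 < x k c.1) :
    below x (insert k N) c = below x N c := by
  rw [below, Finset.filter_insert, if_neg (not_le.2 h), below]

theorem above_insert_of_le {c : Fin D × ℝ} (h : x k c.1 ≤ c.2) :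
    above x (insert k N) c = above x N c := by
  rw [above, Finset.filter_insert, if_neg (not_lt.2 h), above]

theorem above_insert_of_lt {c : Fin D × ℝ} (h : c.2 < x k c.1) :
    above x (insert k N) c = insert k (above x N c) := by
  rw [above, Finset.filter_insert, if_pos h, above]

theorem lower_le {i : ℕ} (hi : i ∈ N) (d : Fin D) : lower x N d ≤ x i d := by
  rw [lower, dif_pos ⟨i, hi⟩]
  exact Finset.inf'_le _ hi

theorem le_upper {i : ℕ} (hi : i ∈ N) (d : Fin D) : x i d ≤ upper x N d := by
  rw [upper, dif_pos ⟨i, hi⟩]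
  exact Finset.le_sup' (fun i => x i d) hi

theorem below_eq_self {c : Fin D × ℝ} (h : upper x N c.1 ≤ c.2) : below x N c = N :=
  Finset.filter_true_of_mem fun _ hi => (le_upper x hi _).trans h

theorem above_eq_empty {c : Fin D × ℝ} (h : upper x N c.1 ≤ c.2) : above x N c = ∅ :=
  Finset.filter_false_of_mem fun _ hi => not_lt.2 ((le_upper x hi _).trans h)

theorem above_eq_self {c : Fin D × ℝ} (h : c.2 < lower x N c.1) : above x N c = N :=
  Finset.filter_true_of_mem fun _ hi => h.trans_le (lower_le x hi _)

theorem below_eq_empty {c : Fin D × ℝ} (h : c.2 < lower x N c.1) : below x N c = ∅ :=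
  Finset.filter_false_of_mem fun _ hi => not_le.2 (h.trans_le (lower_le x hi _))

theorem lower_singleton : lower x {k} = x k := by
  funext d
  simp [lower]

theorem upper_singleton : upper x {k} = x k := by
  funext d
  simp [upper]

/-- A single point spans a box of rate zero, so no cut ever occurs. This is the sibling leaf created
by `newParent`. -/
theorem block_singleton (t : ℝ) :
    block lam x {k} t = Measure.dirac (.leaf ⟨{k}, x k, x k, lam, 1⟩) := by
  rw [block_eq]
  simp [waitLaw, lower_singleton, upper_singleton, haltLaw, freshData]

/-- Above a block started at time `t`, a new parent with time `t` and a cut separating the new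
observation gives the block on all observations with that time and cut at the root. -/
theorem lintegral_newParent_block (hN : N.Nonempty) (hk : k ∉ N) (t : ℝ) {c : Fin D × ℝ}
    (hc : extStart (upper x N) (x k) c.1 < c.2 ∧
      c.2 < extStop (lower x N) (upper x N) (x k) c.1)
    {f : MTree D → ENNReal} (hf : Measurable f) :
    ∫⁻ T, f (newParent lam k (x k) T t c) ∂block lam x N t =
      ∫⁻ T, f T ∂splitLaw lam x (insert k N) t c := by
  have hcard := Finset.card_insert_of_notMem hk
  have hpos := hN.card_pos
  have hm : Measurable fun T => f (newParent lam k (x k) T t c) :=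
    hf.comp (measurable_newParent lam k (x k) measurable_id measurable_const measurable_const)
  have hroot : ∀ T : MTree D, T.root = freshData x N T.root.time →
      ({ T.root.add k (x k) with time := t } : NodeData D) = freshData x (insert k N) t ∧
      T.root.idx.card = N.card := by
    intro T hT
    rw [hT, freshData_add x hN hk]
    exact ⟨rfl, rfl⟩
  unfold extStart extStop at hc
  split_ifs at hc with h
  · have hb : below x (insert k N) c = N := by
      rw [below_insert_of_lt x hc.2, below_eq_self x hc.1.le]
    have ha : above x (insert k N) c = {k} := by
      rw [above_insert_of_lt x hc.2, above_eq_empty x hc.1.le]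
      rfl
    rw [lintegral_splitLaw lam x (by rw [hb]; omega) (by rw [ha, Finset.card_singleton]; omega)
      t hf, hb, ha]
    rw [block_singleton]
    refine Eq.trans ?_ (lintegral_congr fun T₀ => (lintegral_dirac' _
      (show Measurable fun T₁ => f (.node (freshData x (insert k N) t) _ T₀ T₁) from
        hf.comp (by fun_prop))).symm)
    -- `newParent` copies data from the root of `T`, which is known only for trees that a block can
    -- produce.
    refine lintegral_block_congr lam x N t hm (hf.comp (by fun_prop)) fun T hT _ => ?_
    rw [newParent, if_pos hc.2, (hroot T hT).1, (hroot T hT).2, Finset.card_singleton]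
  · have hb : below x (insert k N) c = {k} := by
      rw [below_insert_of_le x hc.1.le, below_eq_empty x hc.2]
      rfl
    have ha : above x (insert k N) c = N := by
      rw [above_insert_of_le x hc.1.le, above_eq_self x hc.2]
    rw [lintegral_splitLaw lam x (by rw [hb, Finset.card_singleton]; omega) (by rw [ha]; omega)
      t hf, hb, ha, block_singleton, lintegral_dirac']
    · refine lintegral_block_congr lam x N t hm (hf.comp (by fun_prop)) fun T hT _ => ?_
      rw [newParent, if_neg (not_lt.2 hc.1.le), (hroot T hT).1, (hroot T hT).2,
        Finset.card_singleton]
    · exact Measurable.lintegral_prod_right' (f := fun p : MTree D × MTree D => f (.node _ _ p.1 p.2))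
        (hf.comp (by fun_prop))

variable (k) in
/-- The law of the continuation of an insertion that creates no new parent at the root. -/
def stayOf (z : Fin D → ℝ) : MTree D → Measure (MTree D)
  | .leaf a => Measure.dirac (.leaf (a.add k z))
  | .node a c L R => stayLaw k z (fun p => insertBlock lam k z p.1 p.2) a c L R

theorem insertBlock_eq (z : Fin D → ℝ) (T : MTree D) (s : ℝ) :
    insertBlock lam k z T s = insertStep lam k z T s (stayOf lam k z T) := by
  cases T <;> rfl

theorem measurable_stayOf (z : Fin D → ℝ) : Measurable (stayOf lam k z) := by
  have h : Measurable fun p : MTree D × Unit => stayOf lam k z p.1 := by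
    refine measurable_mtree_cases (g := fun T (_ : Unit) => stayOf lam k z T) ?_ ?_
    · exact Measure.measurable_dirac.comp (by fun_prop)
    · exact (measurable_stayLaw k z (measurable_insertBlock lam k z)).comp measurable_fst
  exact h.comp (f := fun T => (T, ())) (by fun_prop)

/-- Continuing the insertion below the cut of a block gives the block on all observations with
the same time and cut at the root. -/
theorem lintegral_stayLaw_block (hk : k ∉ N)
    (ih : ∀ M : Finset ℕ, M.card < N.card → M.Nonempty → k ∉ M → ∀ (s : ℝ) (f : MTree D → ENNReal),
      Measurable f → ∫⁻ T, ∫⁻ T', f T' ∂insertBlock lam k (x k) T s ∂block lam x M s =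
        ∫⁻ T, f T ∂block lam x (insert k M) s)
    {c : Fin D × ℝ} (hc : lower x N c.1 < c.2 ∧ c.2 < upper x N c.1) (t : ℝ)
    {f : MTree D → ENNReal} (hf : Measurable f) :
    ∫⁻ T₀, ∫⁻ T₁, ∫⁻ T', f T' ∂stayLaw k (x k) (fun p => insertBlock lam k (x k) p.1 p.2)
        (freshData x N t) ⟨c.1, c.2, (below x N c).card, (above x N c).card⟩ T₀ T₁
      ∂block lam x (above x N c) t ∂block lam x (below x N c) t =
      ∫⁻ T, f T ∂splitLaw lam x (insert k N) t c := by
  obtain ⟨h0, h1⟩ := below_above_nonempty x hc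
  have hN : N.Nonempty := h0.mono (Finset.filter_subset _ _)
  have hb := card_below_lt x h1
  have ha := card_above_lt x h0
  have hkb : k ∉ below x N c := fun h => hk (Finset.mem_filter.1 h).1
  have hka : k ∉ above x N c := fun h => hk (Finset.mem_filter.1 h).1
  have hcard := Finset.card_insert_of_notMem hk
  rcases le_or_gt (x k c.1) c.2 with h | h
  · have hb' := below_insert_of_le x (N := N) h
    have ha' := above_insert_of_le x (N := N) h
    have hcb := Finset.card_insert_of_notMem hkb
    -- The induction hypothesis is applied to the left block, with the untouched right block
    -- integrated out in the test function.
    rw [lintegral_splitLaw lam x (by rw [hb']; omega) (by rw [ha']; omega) t hf, hb', ha',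
      ← ih _ hb h0 hkb t (fun T₀ => ∫⁻ T₁, f (.node (freshData x (insert k N) t)
        ⟨c.1, c.2, (insert k (below x N c)).card, (above x N c).card⟩ T₀ T₁)
          ∂block lam x (above x N c) t)]
    · refine lintegral_congr fun T₀ => ?_
      -- The inserted left tree and the right tree are independent given `T₀`, so their order of
      -- integration is free.
      rw [lintegral_lintegral_swap]
      · refine lintegral_congr fun T₁ => ?_
        simp only [stayLaw, if_pos h]
        rw [lintegral_map hf (by fun_prop), freshData_add x hN hk, hcb]
        rfl
      · exact (hf.comp (by fun_prop)).aemeasurable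
    · exact Measurable.lintegral_prod_right' (f := fun p : MTree D × MTree D =>
        f (.node _ _ p.1 p.2)) (hf.comp (by fun_prop))
  · have hb' := below_insert_of_lt x (N := N) h
    have ha' := above_insert_of_lt x (N := N) h
    have hca := Finset.card_insert_of_notMem hka
    rw [lintegral_splitLaw lam x (by rw [hb']; omega) (by rw [ha']; omega) t hf, hb', ha']
    refine lintegral_congr fun T₀ => ?_
    rw [← ih _ ha h1 hka t (fun T₁ => f (.node (freshData x (insert k N) t)
        ⟨c.1, c.2, (below x N c).card, (insert k (above x N c)).card⟩ T₀ T₁))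
        (hf.comp (by fun_prop))]
    refine lintegral_congr fun T₁ => ?_
    simp only [stayLaw, if_neg (not_le.2 h)]
    rw [lintegral_map hf (by fun_prop), freshData_add x hN hk, hca]
    rfl

end Consistency

/-! ### Adding up the two outcomes of an insertion -/

section Main

variable {D : ℕ} (lam : ℝ) (x : ℕ → Fin D → ℝ) {N : Finset ℕ} {k : ℕ}

/-- Survival probabilities of independent clocks multiply, so their rates add. -/
theorem ofReal_exp_mul (L Λ t : ℝ) :
    ENNReal.ofReal (Real.exp (-(Λ * t))) * ENNReal.ofReal (Real.exp (-(L * t))) =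
      ENNReal.ofReal (Real.exp (-((L + Λ) * t))) := by
  rw [← ENNReal.ofReal_mul (Real.exp_pos _).le, ← Real.exp_add]
  congr 2
  ring

/-- Moves the random root time `τ` from the limit of integration into the integrand, so that Tonelli
applies on a fixed window. -/
theorem setLIntegral_Ico_inter {s τ b : ℝ} (h : τ ≤ b) (g : ℝ → ENNReal) :
    ∫⁻ t in Set.Ico s τ, g t = ∫⁻ t in Set.Ico s b, if t < τ then g t else 0 := by
  rw [← lintegral_indicator measurableSet_Ico, ← lintegral_indicator measurableSet_Ico]
  refine lintegral_congr fun t => ?_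
  simp only [Set.indicator_apply, Set.mem_Ico]
  by_cases h1 : s ≤ t <;> by_cases h2 : t < τ
  · simp [h1, h2, h2.trans_le h]
  · simp [h2]
  · simp [h1]
  · simp [h1]

/-- The contribution of the insertions that create a new parent above the root. -/
theorem lintegral_newParent_part (hN : N.Nonempty) (hk : k ∉ N) (s Λ : ℝ)
    {f : MTree D → ENNReal} (hf : Measurable f) :
    ∫⁻ T, (∫⁻ t in Set.Ico s lam, if t < T.root.time then
        ENNReal.ofReal (Real.exp (-(Λ * (t - s)))) * ∫⁻ c, f (newParent lam k (x k) T t c)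
          ∂cutMeas (extLen (lower x N) (upper x N) (x k)) (extStart (upper x N) (x k))
            (extStop (lower x N) (upper x N) (x k)) else 0) ∂block lam x N s =
      ∫⁻ t in Set.Ico s lam, ENNReal.ofReal
        (Real.exp (-((∑ d, (upper x N d - lower x N d) + Λ) * (t - s)))) *
        ∫⁻ c, ∫⁻ T, f T ∂splitLaw lam x (insert k N) t c
          ∂cutMeas (extLen (lower x N) (upper x N) (x k)) (extStart (upper x N) (x k))
            (extStop (lower x N) (upper x N) (x k)) := by
  set κ := cutMeas (extLen (lower x N) (upper x N) (x k)) (extStart (upper x N) (x k))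
    (extStop (lower x N) (upper x N) (x k)) with hκ
  have hnp : Measurable fun q : (MTree D × ℝ) × (Fin D × ℝ) =>
      f (newParent lam k (x k) q.1.1 q.1.2 q.2) :=
    hf.comp (measurable_newParent lam k (x k) (by fun_prop) (by fun_prop) (by fun_prop))
  have hm : Measurable fun p : MTree D × ℝ => ∫⁻ c, f (newParent lam k (x k) p.1 p.2 c) ∂κ :=
    Measurable.lintegral_prod_right' hnp
  -- With the insertion time `t` outermost, the inner integral is over blocks whose root is later
  -- than `t`, where memorylessness applies.
  rw [lintegral_lintegral_swap]
  · refine setLIntegral_congr_fun measurableSet_Ico fun t ht => ?_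
    have hmt : Measurable fun T => ∫⁻ c, f (newParent lam k (x k) T t c) ∂κ :=
      hm.comp (f := fun T => (T, t)) (by fun_prop)
    rw [lintegral_block_time lam x N ht.1 ht.2 (hmt.const_mul _), lintegral_const_mul _ hmt,
      ← mul_assoc, mul_comm (ENNReal.ofReal _) (ENNReal.ofReal _), ofReal_exp_mul]
    congr 1
    have hswap : Measurable fun p : MTree D × (Fin D × ℝ) =>
        f (newParent lam k (x k) p.1 t p.2) :=
      hnp.comp (f := fun p : MTree D × (Fin D × ℝ) => ((p.1, t), p.2)) (by fun_prop)
    rw [lintegral_lintegral_swap hswap.aemeasurable]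
    refine lintegral_congr_ae ?_
    filter_upwards [ae_cutMeas_mem_Ioo _ _ _] with c hc
    exact lintegral_newParent_block lam x hN hk t hc hf
  · refine Measurable.aemeasurable (Measurable.ite (measurableSet_lt (by fun_prop)
      (by fun_prop)) (Measurable.mul (by fun_prop) hm) measurable_const)

/-- The contribution of the insertions that create no new parent above the root. -/
theorem lintegral_stay_part (hN : N.Nonempty) (hk : k ∉ N)
    (ih : ∀ M : Finset ℕ, M.card < N.card → M.Nonempty → k ∉ M → ∀ (s : ℝ) (f : MTree D → ENNReal),
      Measurable f → ∫⁻ T, ∫⁻ T', f T' ∂insertBlock lam k (x k) T s ∂block lam x M s =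
        ∫⁻ T, f T ∂block lam x (insert k M) s)
    (s Λ : ℝ) {f : MTree D → ENNReal} (hf : Measurable f) :
    ∫⁻ T, ENNReal.ofReal (Real.exp (-(Λ * max (T.root.time - s) 0))) *
        ∫⁻ T', f T' ∂stayOf lam k (x k) T ∂block lam x N s =
      ENNReal.ofReal (Real.exp (-((∑ d, (upper x N d - lower x N d) + Λ) * max (lam - s) 0))) *
        f (.leaf (freshData x (insert k N) lam)) +
      ∫⁻ t in Set.Ico s lam, ENNReal.ofReal
        (Real.exp (-((∑ d, (upper x N d - lower x N d) + Λ) * (t - s)))) *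
        ∫⁻ c, ∫⁻ T, f T ∂splitLaw lam x (insert k N) t c
          ∂cutMeas (fun d => upper x N d - lower x N d) (lower x N) (upper x N) := by
  have hexp : Measurable fun T : MTree D =>
      ENNReal.ofReal (Real.exp (-(Λ * max (T.root.time - s) 0))) := by
    fun_prop
  have hstay := measurable_lintegral_measure (measurable_stayOf lam (k := k) (x k)) hf
  have hprod : Measurable fun T : MTree D =>
      ENNReal.ofReal (Real.exp (-(Λ * max (T.root.time - s) 0))) *
        ∫⁻ T', f T' ∂stayOf lam k (x k) T := hexp.mul hstay
  rw [lintegral_block lam x N s hprod]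
  congr 1
  · simp only [MTree.root, stayOf, lintegral_dirac' _ hf, freshData_add x hN hk]
    rw [← mul_assoc, mul_comm (ENNReal.ofReal _) (ENNReal.ofReal _)]
    simp only [freshData]
    rw [ofReal_exp_mul]
  · refine setLIntegral_congr_fun measurableSet_Ico fun t ht => ?_
    rw [← ofReal_exp_mul, mul_comm (ENNReal.ofReal _) (ENNReal.ofReal _), mul_assoc]
    congr 1
    have hst : Measurable (splitLaw lam x (insert k N) t) :=
      (measurable_splitLaw lam x (insert k N)).comp measurable_prodMk_left
    rw [← lintegral_const_mul _ (measurable_lintegral_measure hst hf)]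
    refine lintegral_congr_ae ?_
    filter_upwards [ae_cutMeas_mem_Ioo _ _ _] with c hc
    obtain ⟨h0, h1⟩ := below_above_nonempty x hc
    rw [lintegral_splitLaw lam x (card_below_lt x h1) (card_above_lt x h0) t hprod]
    simp only [MTree.root, stayOf]
    rw [← lintegral_stayLaw_block lam x hk ih hc t hf]
    have ht0 : max ((freshData x N t).time - s) 0 = t - s := max_eq_left (sub_nonneg.2 ht.1)
    rw [ht0]
    have hst := measurable_lintegral_measure
      (measurable_stayLaw k (x k) (measurable_insertBlock lam k (x k))) hf
    have hst' : Measurable fun p : MTree D × MTree D => ∫⁻ T', f T'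
        ∂stayLaw k (x k) (fun p => insertBlock lam k (x k) p.1 p.2) (freshData x N t)
          ⟨c.1, c.2, (below x N c).card, (above x N c).card⟩ p.1 p.2 :=
      hst.comp (f := fun p : MTree D × MTree D => (freshData x N t,
        (⟨c.1, c.2, (below x N c).card, (above x N c).card⟩ : CutData D), p.1, p.2)) (by fun_prop)
    rw [← lintegral_const_mul _ (Measurable.lintegral_prod_right' hst')]
    refine lintegral_congr fun T₀ => ?_
    exact lintegral_const_mul _ (hst'.comp measurable_prodMk_left)

/-- Strong induction on the number of observations: continued insertions supply the uncut leaf and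
the cuts of the old box, new parents supply the cuts of the extension. -/
theorem lintegral_insertBlock (n : ℕ) : ∀ N : Finset ℕ, N.card = n → N.Nonempty → k ∉ N →
    ∀ (s : ℝ) (f : MTree D → ENNReal), Measurable f →
      ∫⁻ T, ∫⁻ T', f T' ∂insertBlock lam k (x k) T s ∂block lam x N s =
        ∫⁻ T, f T ∂block lam x (insert k N) s := by
  induction n using Nat.strong_induction_on with
  | _ n ih =>
    intro N hNn hN hk s f hf
    have ih' : ∀ M : Finset ℕ, M.card < N.card → M.Nonempty → k ∉ M → ∀ (s : ℝ)
        (f : MTree D → ENNReal), Measurable f →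
        ∫⁻ T, ∫⁻ T', f T' ∂insertBlock lam k (x k) T s ∂block lam x M s =
          ∫⁻ T, f T ∂block lam x (insert k M) s :=
      fun M hM => ih _ (hNn ▸ hM) M rfl
    set Λ := ∑ d, extLen (lower x N) (upper x N) (x k) d with hΛ
    set κ := cutMeas (extLen (lower x N) (upper x N) (x k)) (extStart (upper x N) (x k))
      (extStop (lower x N) (upper x N) (x k)) with hκ
    have hins : Measurable fun T : MTree D => ∫⁻ T', f T' ∂insertBlock lam k (x k) T s :=
      measurable_lintegral_measure (measurable_insertBlock_left lam k (x k) s) hf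
    have hB : Measurable fun T : MTree D =>
        ENNReal.ofReal (Real.exp (-(Λ * max (T.root.time - s) 0))) *
          ∫⁻ T', f T' ∂stayOf lam k (x k) T :=
      Measurable.mul (by fun_prop)
        (measurable_lintegral_measure (measurable_stayOf lam (k := k) (x k)) hf)
    have hnp : Measurable fun q : (MTree D × ℝ) × (Fin D × ℝ) =>
        f (newParent lam k (x k) q.1.1 q.1.2 q.2) :=
      hf.comp (measurable_newParent lam k (x k) (by fun_prop) (by fun_prop) (by fun_prop))
    have hA : Measurable fun T : MTree D => ∫⁻ t in Set.Ico s lam, if t < T.root.time then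
        ENNReal.ofReal (Real.exp (-(Λ * (t - s)))) *
          ∫⁻ c, f (newParent lam k (x k) T t c) ∂κ else 0 :=
      Measurable.lintegral_prod_right' (f := fun p : MTree D × ℝ => if p.2 < p.1.root.time then
          ENNReal.ofReal (Real.exp (-(Λ * (p.2 - s)))) *
            ∫⁻ c, f (newParent lam k (x k) p.1 p.2 c) ∂κ else 0)
        (Measurable.ite (measurableSet_lt (by fun_prop) (by fun_prop))
          (Measurable.mul (by fun_prop) (Measurable.lintegral_prod_right' hnp)) measurable_const)
    -- On trees with a fresh root the rate and the cut measure of the insertion no longer depend on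
    -- `T`, and the integrand splits into its two outcomes.
    rw [lintegral_block_congr lam x N s hins (hB.add hA) fun T hT hTlam => ?_]
    · simp only [Pi.add_apply]
      rw [lintegral_add_left hB, lintegral_stay_part lam x hN hk ih' s Λ hf,
        lintegral_newParent_part lam x hN hk s Λ hf, lintegral_block lam x (insert k N) s hf,
        sum_length_insert x hN, cutMeas_insert x hN, add_assoc, ← hΛ, ← hκ]
      congr 1
      have hms := measurable_splitLaw lam x (insert k N)
      have h1 := measurable_lintegral_cutMeas hms (fun d => upper x N d - lower x N d)
        (lower x N) (upper x N) hf
      have h2 : Measurable fun t => ENNReal.ofReal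
          (Real.exp (-((∑ d, (upper x N d - lower x N d) + Λ) * (t - s)))) :=
        by fun_prop
      refine Eq.trans (lintegral_add_left (h2.mul h1) _).symm ?_
      refine lintegral_congr fun t => ?_
      rw [lintegral_add_measure, mul_add, Pi.mul_apply]
    · have hlo : T.root.lo = lower x N := by rw [hT]; rfl
      have hhi : T.root.hi = upper x N := by rw [hT]; rfl
      rw [insertBlock_eq, lintegral_insertStep lam k (x k) T s _ hf, hlo, hhi, ← hΛ, ← hκ,
        setLIntegral_Ico_inter hTlam]
      rfl

/-- Inserting an observation into a Mondrian block gives a Mondrian block. -/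
theorem block_bind_insertBlock (hN : N.Nonempty) (hk : k ∉ N) (s : ℝ) :
    ((block lam x N s).bind fun T => insertBlock lam k (x k) T s) =
      block lam x (insert k N) s := by
  refine measure_ext_of_lintegral fun f hf => ?_
  rw [lintegral_bind_of_measurable (measurable_insertBlock_left lam k (x k) s) hf]
  exact lintegral_insertBlock lam x _ N rfl hN hk s f hf

end Main

end MPT

end

/-! ### From stored trees to Mondrian Pólya trees -/

theorem mainTheorem1 {D : ℕ} (γ lam : ℝ) (hγ : 0 < γ) (hlam : 0 < lam)
    (x : ℕ → Fin D → ℝ) (N : Finset ℕ) (hN : N.Nonempty) (k : ℕ) (hk : k ∉ N) :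
    (∀ M : Finset ℕ, M.Nonempty →
      MeasureTheory.IsProbabilityMeasure (MPT.mondPolyaTree γ lam x M)) ∧
    (∀ T : MPT.MPTree D,
      MeasureTheory.IsProbabilityMeasure (MPT.insertMPTree γ lam k (x k) T)) ∧
    (MPT.mondPolyaTree γ lam x N).bind (MPT.insertMPTree γ lam k (x k)) =
      MPT.mondPolyaTree γ lam x (insert k N) := by
  have hP := MPT.measurable_withPolya (D := D) γ
  refine ⟨fun M _ => Measure.isProbabilityMeasure_map
      (μ := MPT.block lam x M 0) hP.aemeasurable,
    fun T => Measure.isProbabilityMeasure_map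
      (μ := MPT.insertBlock lam k (x k) T.1 0) hP.aemeasurable, ?_⟩
  have hins : Measurable fun T : MPT.MTree D => MPT.insertBlock lam k (x k) T 0 :=
    MPT.measurable_insertBlock_left lam k (x k) 0
  have hins' : Measurable (MPT.insertMPTree γ lam k (x k)) :=
    (Measure.measurable_map _ hP).comp (hins.comp measurable_fst)
  -- Insertion reads only the stored tree and recomputes the Pólya quantities, so both sides reduce
  -- to integrals of `f ∘ withPolya γ` over stored trees.
  refine MPT.measure_ext_of_lintegral fun f hf => ?_
  rw [MPT.lintegral_bind_of_measurable hins' hf, MPT.mondPolyaTree, MPT.mondPolyaTree,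
    lintegral_map (MPT.measurable_lintegral_measure hins' hf) hP, lintegral_map hf hP,
    MPT.mondrianTree, MPT.mondrianTree, ← MPT.block_bind_insertBlock lam x hN hk 0,
    MPT.lintegral_bind_of_measurable hins (f := fun T => f (MPT.withPolya γ T)) (hf.comp hP)]
  refine lintegral_congr fun T => ?_
  rw [MPT.insertMPTree, lintegral_map hf hP]
  rfl
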